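/- For integers $0\le a\le N$ let $\mathbb{R}^N_a$ be $\mathbb{R}^N$ with the scalar product $\langle v,w\rangle=-\sum_{i\le a}v_iw_i+\sum_{i>a}v_iw_i$, so $\mathbb{R}^N_0=\mathbb{R}^N$. For $c>0$ let $$\mathbb{S}^n_a(c)=\{x\in\mathbb{R}^{n+1}_a:\langle x,x\rangle=1/c\},\qquad \mathbb{H}^n_a(-c)=\{x\in\mathbb{R}^{n+1}_{a+1}:\langle x,x\rangle=-1/c\},$$ with the induced metrics. Put $\mathbb{S}^n(c)=\mathbb{S}^n_0(c)$, let $\mathbb{H}^n(-c)=\{x\in\mathbb{H}^n_0(-c):x_1>0\}$ be the hyperbolic space, and let $dS^n(c)$ and $AdS^n(-c)$ be the semi-Riemannian universal covering spaces of $\mathbb{S}^n_1(c)$ and $\mathbb{H}^n_1(-c)$, respectively. An isometric immersion is an embedding if it is a homeomorphism onto its image with the induced topology. Let $Sol_3$ be $\mathbb{R}^3$ with coordinates $(t,x,y)$ and the metric $dt^2+e^{2t}dx^2+e^{-2t}dy^2$. Then, for every $c>0$, $Sol_3$ admits: (i) non-injective smooth isometric immersions into each of $\mathbb{R}^9$,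 $\mathbb{H}^9(-c)$, $\mathbb{S}^9(c)$, $\mathbb{R}^7_1$, $dS^7(c)$ and $AdS^8(-c)$, and also into the quadrics $\mathbb{S}^7_1(c)$ and $\mathbb{H}^8_1(-c)$; (ii) smooth isometric embeddings into each of $\mathbb{R}^{17}$, $\mathbb{H}^{17}(-c)$, $\mathbb{S}^{19}(c)$, $\mathbb{R}^{11}_1$, $AdS^{12}(-c)$ and $dS^{13}(c)$, and also into the quadrics $\mathbb{H}^{12}_1(-c)$ and $\mathbb{S}^{13}_1(c)$. -/

import Mathlib

open scoped ContDiff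

universe u

/-- The scalar product `-v₁w₁ - … - vₐwₐ + vₐ₊₁wₐ₊₁ + … + v_N w_N` of the semi-Euclidean space
`ℝ^N_a`; for `a = 0` it is the Euclidean scalar product. -/
def semiInner {N : ℕ} (a : ℕ) (v w : Fin N → ℝ) : ℝ :=
  ∑ i : Fin N, (if (i : ℕ) < a then -(v i * w i) else v i * w i)

/-- The quadric `S^n_a(c) = {x ∈ ℝ^{n+1}_a : ⟨x, x⟩ = 1/c}`. -/
def pseudoSphere (n a : ℕ) (c : ℝ) : Set (Fin (n + 1) → ℝ) :=
  {x | semiInner a x x = 1 / c}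

/-- The quadric `H^n_a(-c) = {x ∈ ℝ^{n+1}_{a+1} : ⟨x, x⟩ = -1/c}`. -/
def pseudoHyperbolic (n a : ℕ) (c : ℝ) : Set (Fin (n + 1) → ℝ) :=
  {x | semiInner (a + 1) x x = -(1 / c)}

/-- The hyperbolic space `H^n(-c)`: the connected component `x₁ > 0` of the two-sheeted
hyperboloid `⟨x, x⟩ = -1/c` in `ℝ^{n+1}_1`. -/
def hyperbolicSpace (n : ℕ) (c : ℝ) : Set (Fin (n + 1) → ℝ) :=
  {x | x ∈ pseudoHyperbolic n 0 c ∧ 0 < x 0}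

/-- `p : E → X` is a universal covering of topological spaces. -/
structure IsUniversalCovering {E : Type u} {X : Type*} [TopologicalSpace E] [TopologicalSpace X]
    (p : E → X) : Prop where
  isCoveringMap : IsCoveringMap p
  surjective : Function.Surjective p
  simplyConnected : SimplyConnectedSpace E

/-- The underlying manifold `ℝ³` of `Sol₃`, with coordinates `(t, x, y)`. -/
abbrev Sol3 : Type := Fin 3 → ℝ

/-- The metric `dt² + e^{2t} dx² + e^{-2t} dy²` of `Sol₃` at the point `q`. -/
noncomputable def solMetric (q v w : Sol3) : ℝ :=
  v 0 * w 0 + Real.exp (2 * q 0) * (v 1 * w 1) + Real.exp (-(2 * q 0)) * (v 2 * w 2)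

/-- Smooth isometric immersions of `Sol₃` into a semi-Riemannian manifold `X` whose smooth
structure and metric are pulled back from `ℝ^N_a` along a map `j : X → ℝ^N`. Here `j` is
the identity (for `X = ℝ^N_a`), the inclusion of a quadric, or a covering map onto a quadric
followed by the inclusion. In all three cases `j` is locally a homeomorphism onto an embedded
submanifold, so that a continuous `f : Sol₃ → X` is smooth iff `j ∘ f` is, and the differentials
of `f` and of `j ∘ f` at a point have the same kernel and pull back the same scalar product. -/
structure IsSmoothIsometricImmersion {X : Type*} [TopologicalSpace X] {N : ℕ} (a : ℕ)
    (j : X → (Fin N → ℝ)) (f : Sol3 → X) : Prop where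
  continuous : Continuous f
  smooth : ContDiff ℝ ∞ (j ∘ f)
  immersion : ∀ q : Sol3, Function.Injective (fderiv ℝ (j ∘ f) q)
  isometric : ∀ q v w : Sol3,
    semiInner a (fderiv ℝ (j ∘ f) q v) (fderiv ℝ (j ∘ f) q w) = solMetric q v w

/-- `Sol₃` admits a smooth isometric immersion into `X` that is not injective. -/
def AdmitsNonInjectiveImmersion {X : Type*} [TopologicalSpace X] {N : ℕ} (a : ℕ)
    (j : X → (Fin N → ℝ)) : Prop :=
  ∃ f : Sol3 → X, IsSmoothIsometricImmersion a j f ∧ ¬ Function.Injective f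

/-- `Sol₃` admits a smooth isometric embedding into `X`: an immersion that is a homeomorphism
onto its image with the induced topology. -/
def AdmitsEmbedding {X : Type*} [TopologicalSpace X] {N : ℕ} (a : ℕ)
    (j : X → (Fin N → ℝ)) : Prop :=
  ∃ f : Sol3 → X, IsSmoothIsometricImmersion a j f ∧ Topology.IsEmbedding f

/-- The semi-Euclidean space `ℝ^N_a` as a target. -/
def flatChart (N : ℕ) : (Fin N → ℝ) → (Fin N → ℝ) := id

/-- A quadric as a target, included in its ambient space. -/
def quadricChart {N : ℕ} (Q : Set (Fin N → ℝ)) : Q → (Fin N → ℝ) := Subtype.val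

/-- The total space of a covering `p` of a quadric as a target. -/
def coverChart {N : ℕ} {Q : Set (Fin N → ℝ)} {E : Type*} (p : E → Q) : E → (Fin N → ℝ) :=
  fun e => (p e : Fin N → ℝ)

/-! The construction is an oscillation argument in the style of Blanuša. Take a unit-speed curve `γ`
on a unit sphere, a function `A` of `t` and a frequency `w`. The map `(A / w) γ(w y)` induces `A²
dy²` plus an error `(A' / w)² dt²`, and a large `w` makes the error small. No constant `w` works for
all `t`, so `w` is a step function. Two amplitudes with squares summing to `f²` are used, each
vanishing near the jumps of its own frequency. This realizes `f² dy² + K dt²` with `K`, the squared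
norm `n` and `n'` as small as desired (`exists_isWarpedBlock`).

For Riemannian targets both `e^{2t} dx²` and `e^{-2t} dy²` are realized this way. The missing `(1 -
K) dt²` comes from a curve in `t`: on a line, or on a hyperbola or sphere whose radius absorbs `n`.
For Lorentzian targets and those of index one, `e^{2t} dx²` comes from the surface `u = eᵗ`, `v = eᵗ
x² + φ(t)`, `z = eᵗ x` with form `-du dv + dz²`. It induces `e^{2t} dx² - eᵗ φ' dt²` and has squared
norm `-eᵗ φ`, so `φ` is a free function that corrects either the `dt²` term or the quadric equation.
For a quadric `φ` is spent on the equation, and further coordinates in `t` correct `dt²`.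

The choice of `γ` separates the two claims. The circle is periodic, so at a `t` where one amplitude
vanishes the map repeats. A non-closing spiral on the 2-sphere is a topological embedding, and then
`t`, `x`, `y` can be recovered continuously from the image. -/

open Filter Function Topology

/-! ### Coordinate maps with prescribed norm and energy -/

/-- A map into a coordinate space, with its squared norm and the squared norm of its
differential. -/
structure HasNormEnergy {κ : Type*} [Fintype κ] (F : Sol3 → κ → ℝ) (n : Sol3 → ℝ)
    (E : Sol3 → Sol3 → ℝ) : Prop where
  smooth : ContDiff ℝ ∞ F
  norm : ∀ q, ∑ i, F q i ^ 2 = n q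
  energy : ∀ q v, ∑ i, (fderiv ℝ F q v i) ^ 2 = E q v

theorem fderiv_apply_coord {κ : Type*} [Fintype κ] {F : Sol3 → κ → ℝ} (hF : ContDiff ℝ ∞ F)
    (q v : Sol3) (i : κ) : fderiv ℝ F q v i = fderiv ℝ (fun q => F q i) q v := by
  have h := (hF.differentiable (by simp)) q
  rw [fderiv_pi (fun i => (differentiableAt_pi.1 h) i)]
  rfl

theorem ContDiff.sumElim {ι κ : Type*} [Fintype ι] [Fintype κ] {F : Sol3 → ι → ℝ}
    {G : Sol3 → κ → ℝ} (hF : ContDiff ℝ ∞ F) (hG : ContDiff ℝ ∞ G) :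
    ContDiff ℝ ∞ (fun q => (Sum.elim (F q) (G q) : ι ⊕ κ → ℝ)) := by
  rw [contDiff_pi] at *
  rintro (i | i)
  · exact hF i
  · exact hG i

theorem fderiv_sumElim {ι κ : Type*} [Fintype ι] [Fintype κ] {F : Sol3 → ι → ℝ}
    {G : Sol3 → κ → ℝ} (hF : ContDiff ℝ ∞ F) (hG : ContDiff ℝ ∞ G) (q v : Sol3) :
    fderiv ℝ (fun q => (Sum.elim (F q) (G q) : ι ⊕ κ → ℝ)) q v =
      Sum.elim (fderiv ℝ F q v) (fderiv ℝ G q v) := by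
  ext (i | i)
  · rw [fderiv_apply_coord (hF.sumElim hG), Sum.elim_inl, fderiv_apply_coord hF]; rfl
  · rw [fderiv_apply_coord (hF.sumElim hG), Sum.elim_inr, fderiv_apply_coord hG]; rfl

theorem HasNormEnergy.sumElim {ι κ : Type*} [Fintype ι] [Fintype κ] {F : Sol3 → ι → ℝ}
    {G : Sol3 → κ → ℝ} {n m : Sol3 → ℝ} {E E' : Sol3 → Sol3 → ℝ}
    (hF : HasNormEnergy F n E) (hG : HasNormEnergy G m E') :
    HasNormEnergy (fun q => (Sum.elim (F q) (G q) : ι ⊕ κ → ℝ)) (fun q => n q + m q)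
      (fun q v => E q v + E' q v) where
  smooth := hF.smooth.sumElim hG.smooth
  norm q := by simp [Fintype.sum_sum_type, hF.norm, hG.norm]
  energy q v := by
    rw [fderiv_sumElim hF.smooth hG.smooth]
    simp [Fintype.sum_sum_type, hF.energy, hG.energy]

theorem HasNormEnergy.of_scalar {g : Sol3 → ℝ} {D : Sol3 → Sol3 → ℝ} (hg : ContDiff ℝ ∞ g)
    (hD : ∀ q v, fderiv ℝ g q v = D q v) :
    HasNormEnergy (fun q (_ : Unit) => g q) (fun q => g q ^ 2) (fun q v => D q v ^ 2) where
  smooth := contDiff_pi.2 fun _ => hg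
  norm q := by simp
  energy q v := by
    have h : ContDiff ℝ ∞ (fun q (_ : Unit) => g q) := contDiff_pi.2 fun _ => hg
    simp [fderiv_apply_coord h, hD]

/-- The zero-dimensional coordinate map. -/
theorem HasNormEnergy.empty :
    HasNormEnergy (fun _ (i : Empty) => i.elim) (fun _ => 0) (fun _ _ => 0) where
  smooth := contDiff_pi.2 fun i => i.elim
  norm q := by simp
  energy q v := by simp

/-- Coordinate maps `F` and `G`, of negative and positive sign, that together induce the metric
of `Sol₃`. -/
structure IsIsometricPair {ι κ : Type*} [Fintype ι] [Fintype κ] (F : Sol3 → ι → ℝ)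
    (G : Sol3 → κ → ℝ) : Prop where
  smooth_neg : ContDiff ℝ ∞ F
  smooth_pos : ContDiff ℝ ∞ G
  isometric : ∀ q v, -∑ i, (fderiv ℝ F q v i) ^ 2 + ∑ i, (fderiv ℝ G q v i) ^ 2 =
    solMetric q v v

theorem HasNormEnergy.isIsometricPair {ι κ : Type*} [Fintype ι] [Fintype κ] {F : Sol3 → ι → ℝ}
    {G : Sol3 → κ → ℝ} {n m : Sol3 → ℝ} {E E' : Sol3 → Sol3 → ℝ}
    (hF : HasNormEnergy F n E) (hG : HasNormEnergy G m E')
    (h : ∀ q v, -E q v + E' q v = solMetric q v v) : IsIsometricPair F G where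
  smooth_neg := hF.smooth
  smooth_pos := hG.smooth
  isometric q v := by rw [hF.energy, hG.energy, h]

/-! ### Placement in semi-Euclidean space -/

/-- Coordinates placed in `ℝ^N` along an injection of index sets, all others being zero. -/
noncomputable def placeCoords {α : Type*} [Fintype α] {N : ℕ} (e : α → Fin N) :
    (α → ℝ) →L[ℝ] (Fin N → ℝ) :=
  LinearMap.toContinuousLinearMap (Function.ExtendByZero.linearMap ℝ e)

theorem placeCoords_apply {α : Type*} [Fintype α] {N : ℕ} {e : α → Fin N} (he : Injective e)
    (z : α → ℝ) (i : α) : placeCoords e z (e i) = z i := by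
  simp only [placeCoords, Function.ExtendByZero.linearMap]
  exact he.extend_apply _ _ _

theorem placeCoords_of_notMem {α : Type*} [Fintype α] {N : ℕ} {e : α → Fin N}
    (z : α → ℝ) {j : Fin N} (hj : j ∉ Set.range e) : placeCoords e z j = 0 := by
  simp only [placeCoords, Function.ExtendByZero.linearMap]
  exact Function.extend_apply' _ _ _ hj

/-- An injection of index sets respecting the signature of `ℝ^N_a`. -/
structure IsSignatureInjection {ι κ : Type*} {N : ℕ} (a : ℕ) (e : ι ⊕ κ → Fin N) : Prop where
  injective : Injective e
  neg : ∀ i, (e (.inl i) : ℕ) < a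
  pos : ∀ k, ¬ (e (.inr k) : ℕ) < a

/-- Negative directions must be filled exactly, since `a` is the index of the target. Surplus
positive directions stay zero, so any larger `N` is allowed. -/
theorem exists_isSignatureInjection (ι κ : Type*) [Fintype ι] [Fintype κ] {a N : ℕ}
    (hι : Fintype.card ι = a) (hκ : a + Fintype.card κ ≤ N) :
    ∃ e : ι ⊕ κ → Fin N, IsSignatureInjection a e := by
  let e₁ := Fintype.equivFinOfCardEq hι
  let e₂ := Fintype.equivFin κ
  refine ⟨fun s => Fin.castLE hκ (finSumFinEquiv (Sum.map e₁ e₂ s)), ?_, ?_, ?_⟩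
  · exact (Fin.castLE_injective hκ).comp (finSumFinEquiv.injective.comp
      (e₁.injective.sumMap e₂.injective))
  · intro i; simp
  · intro i; simp

theorem IsSignatureInjection.semiInner_placeCoords {ι κ : Type*} [Fintype ι] [Fintype κ]
    {N a : ℕ} {e : ι ⊕ κ → Fin N} (he : IsSignatureInjection a e) (z w : ι ⊕ κ → ℝ) :
    semiInner a (placeCoords e z) (placeCoords e w) =
      -∑ i, z (.inl i) * w (.inl i) + ∑ k, z (.inr k) * w (.inr k) := by
  unfold semiInner
  rw [← Fintype.sum_of_injective e he.injective
    (fun s => Sum.elim (fun i => -(z (.inl i) * w (.inl i)))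
      (fun k => z (.inr k) * w (.inr k)) s)]
  · simp [Fintype.sum_sum_type]
  · intro j hj
    simp [placeCoords_of_notMem _ hj]
  · rintro (i | k)
    · simp [placeCoords_apply he.injective, he.neg]
    · simp [placeCoords_apply he.injective, he.pos]

theorem isInducing_placeCoords {α : Type*} [Fintype α] {N : ℕ} {e : α → Fin N}
    (he : Injective e) : IsInducing (placeCoords e) := by
  have : LeftInverse (fun (y : Fin N → ℝ) i => y (e i)) (placeCoords e) := fun z => by
    ext i; exact placeCoords_apply he z i
  exact (this.isEmbedding (by fun_prop) (placeCoords e).continuous).isInducing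

/-- The map into `ℝ^N_a` with the given coordinates. -/
noncomputable def placePair {ι κ : Type*} [Fintype ι] [Fintype κ] {N : ℕ}
    (e : ι ⊕ κ → Fin N) (z : ι → ℝ) (w : κ → ℝ) : Fin N → ℝ :=
  placeCoords e (Sum.elim z w)

theorem continuous_placePair {T ι κ : Type*} [TopologicalSpace T] [Fintype ι] [Fintype κ]
    {N : ℕ} (e : ι ⊕ κ → Fin N) {F : T → ι → ℝ} {G : T → κ → ℝ} (hF : Continuous F)
    (hG : Continuous G) : Continuous (fun q => placePair e (F q) (G q)) := by
  refine (placeCoords e).continuous.comp (continuous_pi ?_)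
  rintro (i | i)
  · exact (continuous_apply i).comp hF
  · exact (continuous_apply i).comp hG

theorem isInducing_placePair {T ι κ : Type*} [TopologicalSpace T] [Fintype ι] [Fintype κ]
    {N : ℕ} {e : ι ⊕ κ → Fin N} (he : Injective e) {F : T → ι → ℝ} {G : T → κ → ℝ}
    (h : IsInducing (fun q => (F q, G q))) :
    IsInducing (fun q => placePair e (F q) (G q)) := by
  refine (isInducing_placeCoords he).comp ?_
  refine IsInducing.of_comp (g := fun z : ι ⊕ κ → ℝ => ((fun i => z (.inl i)), fun k => z (.inr k)))
    ?_ (by fun_prop) h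
  have h1 := h.continuous.fst
  have h2 := h.continuous.snd
  refine continuous_pi ?_
  rintro (i | i)
  · exact (continuous_apply i).comp h1
  · exact (continuous_apply i).comp h2

theorem IsSignatureInjection.semiInner_placePair {ι κ : Type*} [Fintype ι] [Fintype κ]
    {N a : ℕ} {e : ι ⊕ κ → Fin N} (he : IsSignatureInjection a e) (z z' : ι → ℝ) (w w' : κ → ℝ) :
    semiInner a (placePair e z w) (placePair e z' w') = -∑ i, z i * z' i + ∑ k, w k * w' k :=
  he.semiInner_placeCoords _ _

theorem solMetric_self_eq_zero {q v : Sol3} (h : solMetric q v v = 0) : v = 0 := by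
  unfold solMetric at h
  have h1 := Real.exp_pos (2 * q 0)
  have h2 := Real.exp_pos (-(2 * q 0))
  have e0 := mul_self_nonneg (v 0)
  have e1 := mul_nonneg h1.le (mul_self_nonneg (v 1))
  have e2 := mul_nonneg h2.le (mul_self_nonneg (v 2))
  have k0 : v 0 * v 0 = 0 := by linarith
  have k1 : Real.exp (2 * q 0) * (v 1 * v 1) = 0 := by linarith
  have k2 : Real.exp (-(2 * q 0)) * (v 2 * v 2) = 0 := by linarith
  ext i
  fin_cases i
  · simpa using k0
  · simpa using k1
  · simpa using k2

/-- Polarization recovers the bilinear form from its diagonal. Injectivity of the differential is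
then forced by positive definiteness of the metric of `Sol₃`, whatever the signature of the target.
-/
theorem IsIsometricPair.isSmoothIsometricImmersion {X ι κ : Type*} [TopologicalSpace X]
    [Fintype ι] [Fintype κ] {N a : ℕ} {e : ι ⊕ κ → Fin N} (he : IsSignatureInjection a e)
    {F : Sol3 → ι → ℝ} {G : Sol3 → κ → ℝ} (hFG : IsIsometricPair F G) {j : X → Fin N → ℝ}
    {f : Sol3 → X} (hf : Continuous f) (hj : ∀ q, j (f q) = placePair e (F q) (G q)) :
    IsSmoothIsometricImmersion a j f := by
  have hjf : j ∘ f = placeCoords e ∘ fun q => Sum.elim (F q) (G q) := funext hj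
  have hs := hFG.smooth_neg.sumElim hFG.smooth_pos
  have hd : ∀ q v, fderiv ℝ (j ∘ f) q v =
      placePair e (fderiv ℝ F q v) (fderiv ℝ G q v) := fun q v => by
    rw [hjf, ((placeCoords e).hasFDerivAt.comp q
      (hs.differentiable (by simp) q).hasFDerivAt).fderiv,
      ContinuousLinearMap.comp_apply, fderiv_sumElim hFG.smooth_neg hFG.smooth_pos]
    rfl
  have hq : ∀ q v, -∑ i, fderiv ℝ F q v i * fderiv ℝ F q v i +
      ∑ i, fderiv ℝ G q v i * fderiv ℝ G q v i = solMetric q v v := fun q v => by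
    simpa only [sq] using hFG.isometric q v
  have hiso : ∀ q v w : Sol3,
      semiInner a (fderiv ℝ (j ∘ f) q v) (fderiv ℝ (j ∘ f) q w) = solMetric q v w := by
    intro q v w
    rw [hd, hd, he.semiInner_placePair]
    have h1 := hq q (v + w)
    have h2 := hq q v
    have h3 := hq q w
    simp only [map_add, Pi.add_apply, add_mul, mul_add, Finset.sum_add_distrib] at h1
    have c1 : ∑ i, fderiv ℝ F q w i * fderiv ℝ F q v i =
      ∑ i, fderiv ℝ F q v i * fderiv ℝ F q w i := Finset.sum_congr rfl fun _ _ => mul_comm _ _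
    have c2 : ∑ i, fderiv ℝ G q w i * fderiv ℝ G q v i =
      ∑ i, fderiv ℝ G q v i * fderiv ℝ G q w i := Finset.sum_congr rfl fun _ _ => mul_comm _ _
    rw [c1, c2] at h1
    simp only [solMetric, Pi.add_apply] at h1 h2 h3 ⊢
    linarith
  refine ⟨hf, hjf ▸ (placeCoords e).contDiff.comp hs, fun q v w hvw => ?_, hiso⟩
  have h0 : fderiv ℝ (j ∘ f) q (v - w) = 0 := by rw [map_sub, sub_eq_zero]; exact hvw
  have h1 := hiso q (v - w) (v - w)
  rw [h0] at h1
  exact sub_eq_zero.1 (solMetric_self_eq_zero (h1.symm.trans (by simp [semiInner])))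

/-- If `j ∘ f` is inducing, so is `f`. Injectivity is automatic because the domain is Hausdorff. -/
theorem IsIsometricPair.admitsEmbedding {X ι κ : Type*} [TopologicalSpace X]
    [Fintype ι] [Fintype κ] {N a : ℕ} {e : ι ⊕ κ → Fin N} (he : IsSignatureInjection a e)
    {F : Sol3 → ι → ℝ} {G : Sol3 → κ → ℝ} (hFG : IsIsometricPair F G)
    (hi : IsInducing (fun q => (F q, G q))) {j : X → Fin N → ℝ} (hjc : Continuous j)
    {f : Sol3 → X} (hf : Continuous f) (hj : ∀ q, j (f q) = placePair e (F q) (G q)) :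
    AdmitsEmbedding a j := by
  refine ⟨f, hFG.isSmoothIsometricImmersion he hf hj, ?_⟩
  have h : IsInducing (j ∘ f) := by
    rw [show j ∘ f = _ from funext hj]
    exact isInducing_placePair he.injective hi
  exact (IsInducing.of_comp hf hjc h).isEmbedding

/-! ### Antiderivatives and unit-speed curves on spheres -/

theorem exists_smooth_antideriv {g : ℝ → ℝ} (hg : ContDiff ℝ ∞ g) :
    ∃ G : ℝ → ℝ, ContDiff ℝ ∞ G ∧ ∀ t, HasDerivAt G (g t) t := by
  have h : ∀ t, HasDerivAt (fun x => ∫ y in (0 : ℝ)..x, g y) (g t) t := fun t =>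
    intervalIntegral.integral_hasDerivAt_right (hg.continuous.intervalIntegrable _ _)
      (hg.continuous.stronglyMeasurableAtFilter _ _) hg.continuous.continuousAt
  refine ⟨_, contDiff_infty_iff_deriv.2 ⟨fun t => (h t).differentiableAt, ?_⟩, h⟩
  rwa [show deriv (fun x => ∫ y in (0 : ℝ)..x, g y) = g from funext fun t => (h t).deriv]

/-- A smooth unit-speed curve on the unit sphere. -/
structure IsUnitSphereCurve {ι : Type*} [Fintype ι] (γ : ℝ → ι → ℝ) : Prop where
  smooth : ContDiff ℝ ∞ γ
  norm : ∀ s, ∑ i, γ s i ^ 2 = 1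
  speed : ∀ s, ∑ i, deriv γ s i ^ 2 = 1

theorem IsUnitSphereCurve.hasDerivAt {ι : Type*} [Fintype ι] {γ : ℝ → ι → ℝ}
    (hγ : IsUnitSphereCurve γ) (s : ℝ) (i : ι) :
    HasDerivAt (fun s => γ s i) (deriv γ s i) s :=
  hasDerivAt_pi.1 (hγ.smooth.differentiable (by simp) s).hasDerivAt i

theorem IsUnitSphereCurve.orthogonal {ι : Type*} [Fintype ι] {γ : ℝ → ι → ℝ}
    (hγ : IsUnitSphereCurve γ) (s : ℝ) : ∑ i, γ s i * deriv γ s i = 0 := by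
  have h1 : HasDerivAt (fun s => ∑ i, γ s i ^ 2) (∑ i, 2 * (γ s i * deriv γ s i)) s := by
    refine HasDerivAt.fun_sum fun i _ => ?_
    convert! (hγ.hasDerivAt s i).pow 2 using 1
    simp; ring
  have h2 : HasDerivAt (fun s => ∑ i, γ s i ^ 2) 0 s := by
    simp only [hγ.norm]; exact hasDerivAt_const _ _
  have := h1.unique h2
  rw [← Finset.mul_sum] at this
  linarith

theorem isUnitSphereCurve_of_hasDerivAt {ι : Type*} [Fintype ι] {γ γ' : ℝ → ι → ℝ}
    (hs : ∀ i, ContDiff ℝ ∞ fun s => γ s i) (hd : ∀ s i, HasDerivAt (fun s => γ s i) (γ' s i) s)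
    (hn : ∀ s, ∑ i, γ s i ^ 2 = 1) (hv : ∀ s, ∑ i, γ' s i ^ 2 = 1) : IsUnitSphereCurve γ where
  smooth := contDiff_pi.2 hs
  norm := hn
  speed s := by rw [(hasDerivAt_pi.2 (hd s)).deriv]; exact hv s

/-- The unit circle. -/
noncomputable def circleCurve (s : ℝ) : Fin 2 → ℝ := ![Real.cos s, Real.sin s]

theorem isUnitSphereCurve_circleCurve : IsUnitSphereCurve circleCurve := by
  refine isUnitSphereCurve_of_hasDerivAt (γ' := fun s => ![-Real.sin s, Real.cos s]) ?_ ?_ ?_ ?_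
  · intro i; fin_cases i
    · exact Real.contDiff_cos
    · exact Real.contDiff_sin
  · intro s i; fin_cases i
    · exact Real.hasDerivAt_cos s
    · exact Real.hasDerivAt_sin s
  · intro s; simp [circleCurve]
  · intro s; simp

theorem circleCurve_periodic : Periodic circleCurve (2 * Real.pi) := fun s => by
  simp [circleCurve]

/-- A spiral whose latitude `arctan s / 2` increases strictly inside `(-π/4, π/4)`. The third
coordinate alone then embeds the line, and the longitude is free to make the speed one. -/
theorem exists_isInducing_unitSphereCurve :
    ∃ γ : ℝ → Fin 3 → ℝ, IsUnitSphereCurve γ ∧ IsInducing γ := by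
  set θ : ℝ → ℝ := fun s => Real.arctan s / 2 with hθ
  have hθs : ContDiff ℝ ∞ θ := Real.contDiff_arctan.div_const 2
  have hθd : ∀ s, HasDerivAt θ (1 / (1 + s ^ 2) / 2) s := fun s =>
    (Real.hasDerivAt_arctan s).div_const 2
  have hlo : ∀ s, -(Real.pi / 2) < θ s := fun s => by
    have := Real.neg_pi_div_two_lt_arctan s
    have := Real.pi_pos
    simp only [hθ]; linarith
  have hhi : ∀ s, θ s < Real.pi / 2 := fun s => by
    have := Real.arctan_lt_pi_div_two s
    have := Real.pi_pos
    simp only [hθ]; linarith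
  have hcos : ∀ s, 0 < Real.cos (θ s) := fun s => Real.cos_pos_of_mem_Ioo ⟨hlo s, hhi s⟩
  have hle : ∀ s : ℝ, (1 / (1 + s ^ 2) / 2) ^ 2 < 1 := fun s => by
    have h1 : 1 / (1 + s ^ 2) ≤ 1 := by rw [div_le_one (by positivity)]; nlinarith [sq_nonneg s]
    have h2 : 0 < 1 / (1 + s ^ 2) := by positivity
    nlinarith
  -- Angular speed in longitude, solved from `θ'² + cos² θ · φ'² = 1`; `θ' ≤ 1/2` keeps the radicand
  -- positive.
  set g : ℝ → ℝ := fun s => √(1 - (1 / (1 + s ^ 2) / 2) ^ 2) / Real.cos (θ s) with hg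
  have hgs : ContDiff ℝ ∞ g := by
    refine ContDiff.div (ContDiff.sqrt ?_ fun s => (sub_pos.2 (hle s)).ne')
      (Real.contDiff_cos.comp hθs) fun s => (hcos s).ne'
    refine contDiff_const.sub (((contDiff_const.div ?_ ?_).div_const 2).pow 2)
    · fun_prop
    · intro s; positivity
  obtain ⟨φ, hφs, hφd⟩ := exists_smooth_antideriv hgs
  refine ⟨fun s => ![Real.cos (θ s) * Real.cos (φ s), Real.cos (θ s) * Real.sin (φ s),
    Real.sin (θ s)], ?_, ?_⟩
  · refine isUnitSphereCurve_of_hasDerivAt (γ' := fun s =>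
      ![-Real.sin (θ s) * (1 / (1 + s ^ 2) / 2) * Real.cos (φ s) +
          Real.cos (θ s) * (-Real.sin (φ s) * g s),
        -Real.sin (θ s) * (1 / (1 + s ^ 2) / 2) * Real.sin (φ s) +
          Real.cos (θ s) * (Real.cos (φ s) * g s),
        Real.cos (θ s) * (1 / (1 + s ^ 2) / 2)]) ?_ ?_ ?_ ?_
    · intro i; fin_cases i
      · exact (Real.contDiff_cos.comp hθs).mul (Real.contDiff_cos.comp hφs)
      · exact (Real.contDiff_cos.comp hθs).mul (Real.contDiff_sin.comp hφs)
      · exact Real.contDiff_sin.comp hθs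
    · intro s i; fin_cases i
      · exact (hθd s).cos.mul (hφd s).cos
      · exact (hθd s).cos.mul (hφd s).sin
      · exact (hθd s).sin
    · intro s
      have h1 := Real.sin_sq_add_cos_sq (θ s)
      have h2 := Real.sin_sq_add_cos_sq (φ s)
      simp only [Fin.sum_univ_three, Matrix.cons_val]
      linear_combination h1 + Real.cos (θ s) ^ 2 * h2
    · intro s
      have h1 := Real.sin_sq_add_cos_sq (θ s)
      have h2 := Real.sin_sq_add_cos_sq (φ s)
      have h3 : (Real.cos (θ s) * g s) ^ 2 = 1 - (1 / (1 + s ^ 2) / 2) ^ 2 := by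
        simp only [hg]
        rw [mul_div_cancel₀ _ (hcos s).ne', Real.sq_sqrt (sub_pos.2 (hle s)).le]
      simp only [Fin.sum_univ_three, Matrix.cons_val]
      generalize 1 / (1 + s ^ 2) / 2 = p at *
      generalize g s = G at *
      linear_combination (p ^ 2) * h1 + ((Real.sin (θ s) * p) ^ 2 + (Real.cos (θ s) * G) ^ 2) * h2
        + h3
  · refine IsInducing.of_comp (g := fun z : Fin 3 → ℝ => z 2) ?_ (by fun_prop) ?_
    · refine continuous_pi fun i => ?_
      fin_cases i
      · exact ((Real.contDiff_cos.comp hθs).mul (Real.contDiff_cos.comp hφs)).continuous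
      · exact ((Real.contDiff_cos.comp hθs).mul (Real.contDiff_sin.comp hφs)).continuous
      · exact (Real.contDiff_sin.comp hθs).continuous
    · have hm : StrictMono fun s => Real.sin (θ s) := fun s s' h => by
        refine Real.strictMonoOn_sin ⟨(hlo s).le, (hhi s).le⟩ ⟨(hlo s').le, (hhi s').le⟩ ?_
        simp only [hθ]
        linarith [Real.arctan_strictMono h]
      exact (hm.isEmbedding_of_ordConnected
        (isPreconnected_range (Real.contDiff_sin.comp hθs).continuous).ordConnected).isInducing

theorem isInducing_of_hasDerivAt_pos {θ θ' : ℝ → ℝ} (h : ∀ t, HasDerivAt θ (θ' t) t)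
    (hpos : ∀ t, 0 < θ' t) : IsInducing θ := by
  have hm : StrictMono θ := strictMono_of_deriv_pos fun t => by rw [(h t).deriv]; exact hpos t
  have hc : Continuous θ := continuous_iff_continuousAt.2 fun t => (h t).continuousAt
  exact (hm.isEmbedding_of_ordConnected (isPreconnected_range hc).ordConnected).isInducing

/-! ### Step frequencies and complementary amplitudes -/

/-- On each interval `[2n + d, 2n + d + 2)` compactness bounds `g`, and a constant above the bound
is taken there. Jumps occur only at the points `2n + d`. -/
theorem exists_step_bound {g : ℝ → ℝ} (hg : Continuous g) (d : ℝ) :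
    ∃ w : ℝ → ℝ, (∀ t, g t ≤ w t) ∧ (∀ t, 0 < w t) ∧
      ∀ t₀, (∀ n : ℤ, t₀ ≠ 2 * n + d) → ∀ᶠ t in 𝓝 t₀, w t = w t₀ := by
  have hb : ∀ n : ℤ, ∃ C : ℝ, ∀ t ∈ Set.Icc (2 * n + d) (2 * n + d + 2), ‖g t‖ ≤ C := fun n =>
    isCompact_Icc.exists_bound_of_continuousOn hg.continuousOn
  choose C hC using hb
  refine ⟨fun t => |C ⌊(t - d) / 2⌋| + 1, fun t => ?_, fun t => by positivity, fun t₀ ht₀ => ?_⟩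
  · have h1 := Int.floor_le ((t - d) / 2)
    have h2 := Int.lt_floor_add_one ((t - d) / 2)
    have := hC ⌊(t - d) / 2⌋ t ⟨by linarith, by linarith⟩
    have h3 := le_abs_self (g t)
    have h4 := le_abs_self (C ⌊(t - d) / 2⌋)
    rw [Real.norm_eq_abs] at this
    linarith
  · have h1 : (⌊(t₀ - d) / 2⌋ : ℝ) < (t₀ - d) / 2 :=
      lt_of_le_of_ne (Int.floor_le _) fun h => ht₀ _ (by rw [h]; ring)
    have h2 := Int.lt_floor_add_one ((t₀ - d) / 2)
    have hc : ContinuousAt (fun t : ℝ => (t - d) / 2) t₀ := by fun_prop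
    filter_upwards [hc.eventually (Ioo_mem_nhds h1 h2)] with t ht
    rw [show ⌊(t - d) / 2⌋ = ⌊(t₀ - d) / 2⌋ from Int.floor_eq_iff.2 ⟨ht.1.le, ht.2⟩]

/-- Two smooth functions whose squares sum to one, each compatible with step functions that
are arbitrarily large. -/
theorem exists_amplitudes : ∃ a : Fin 2 → ℝ → ℝ, (∀ i, ContDiff ℝ ∞ (a i)) ∧
    (∀ t, a 0 t ^ 2 + a 1 t ^ 2 = 1) ∧ (∃ t, a 1 t = 0) ∧
    ∀ g : ℝ → ℝ, Continuous g → ∀ i, ∃ w : ℝ → ℝ, (∀ t, g t ≤ w t) ∧ (∀ t, 0 < w t) ∧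
      ∀ t₀, ∀ᶠ t in 𝓝 t₀, a i t = 0 ∨ w t = w t₀ := by
  -- `u` is one near the even integers and zero near the odd ones. So `sin (π u / 2)` vanishes near
  -- odd integers and `cos (π u / 2)` near even ones, where the jumps of the respective frequencies
  -- are put (`d = 1` and `d = 0`).
  set u : ℝ → ℝ := fun t => Real.smoothTransition (1 / 2 + Real.cos (Real.pi * t)) with hu
  have hus : ContDiff ℝ ∞ u := Real.smoothTransition.contDiff.comp
    (contDiff_const.add (Real.contDiff_cos.comp (contDiff_const.mul contDiff_id)))
  have hc : Continuous fun t => Real.cos (Real.pi * t) := by fun_prop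
  refine ⟨![fun t => Real.sin (Real.pi / 2 * u t), fun t => Real.cos (Real.pi / 2 * u t)],
    ?_, ?_, ⟨0, ?_⟩, ?_⟩
  · intro i; fin_cases i
    · exact Real.contDiff_sin.comp (contDiff_const.mul hus)
    · exact Real.contDiff_cos.comp (contDiff_const.mul hus)
  · intro t; simp
  · simp [hu, Real.smoothTransition.one_of_one_le (show (1 : ℝ) ≤ 2⁻¹ + 1 by norm_num)]
  · intro g hg i; fin_cases i
    · obtain ⟨w, h1, h2, h3⟩ := exists_step_bound hg 1
      refine ⟨w, h1, h2, fun t₀ => ?_⟩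
      by_cases h : ∀ n : ℤ, t₀ ≠ 2 * n + 1
      · exact (h3 t₀ h).mono fun t ht => Or.inr ht
      · push Not at h
        obtain ⟨n, rfl⟩ := h
        have h0 : Real.cos (Real.pi * (2 * n + 1)) < -(1 / 2) := by
          rw [show Real.pi * (2 * n + 1) = Real.pi + n * (2 * Real.pi) by ring,
            Real.cos_add_int_mul_two_pi, Real.cos_pi]
          norm_num
        filter_upwards [hc.continuousAt.eventually (gt_mem_nhds h0)] with t ht
        left
        have : u t = 0 := Real.smoothTransition.zero_of_nonpos (by linarith)
        simp [this]
    · obtain ⟨w, h1, h2, h3⟩ := exists_step_bound hg 0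
      refine ⟨w, h1, h2, fun t₀ => ?_⟩
      by_cases h : ∀ n : ℤ, t₀ ≠ 2 * n + 0
      · exact (h3 t₀ h).mono fun t ht => Or.inr ht
      · push Not at h
        obtain ⟨n, rfl⟩ := h
        have h0 : 1 / 2 < Real.cos (Real.pi * (2 * n + 0)) := by
          rw [show Real.pi * (2 * n + 0) = 0 + n * (2 * Real.pi) by ring,
            Real.cos_add_int_mul_two_pi, Real.cos_zero]
          norm_num
        filter_upwards [hc.continuousAt.eventually (lt_mem_nhds h0)] with t ht
        left
        have : u t = 1 := Real.smoothTransition.one_of_one_le (by linarith)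
        simp [this]

/-! ### Oscillating curves with step frequency -/

section Oscillation

variable {ι : Type*} [Fintype ι] {γ : ℝ → ι → ℝ} {A w : ℝ → ℝ}

/-- The curve `γ` run through in the direction `m` with frequency `w` and amplitude `A / w`. -/
noncomputable def oscillatingCurve (γ : ℝ → ι → ℝ) (A w : ℝ → ℝ) (m : Fin 3) (q : Sol3) : ι → ℝ :=
  fun i => A (q 0) / w (q 0) * γ (w (q 0) * q m) i

/-- Near `t₀` the frequency can be frozen: wherever it differs from `w t₀`, both quotients are zero.
-/
theorem eventually_div_eq (hw : ∀ t₀, ∀ᶠ t in 𝓝 t₀, A t = 0 ∨ w t = w t₀) (t₀ : ℝ) :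
    (fun t => A t / w t) =ᶠ[𝓝 t₀] fun t => A t / w t₀ := by
  filter_upwards [hw t₀] with t ht
  rcases ht with h | h <;> simp [h]

theorem contDiff_div_step (hA : ContDiff ℝ ∞ A)
    (hw : ∀ t₀, ∀ᶠ t in 𝓝 t₀, A t = 0 ∨ w t = w t₀) : ContDiff ℝ ∞ fun t => A t / w t :=
  contDiff_iff_contDiffAt.2 fun t₀ =>
    (hA.div_const (w t₀)).contDiffAt.congr_of_eventuallyEq (eventually_div_eq hw t₀)

theorem hasDerivAt_div_step (hA : ContDiff ℝ ∞ A)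
    (hw : ∀ t₀, ∀ᶠ t in 𝓝 t₀, A t = 0 ∨ w t = w t₀) (t₀ : ℝ) :
    HasDerivAt (fun t => A t / w t) (deriv A t₀ / w t₀) t₀ :=
  ((hA.differentiable (by simp) t₀).hasDerivAt.div_const (w t₀)).congr_of_eventuallyEq
    (eventually_div_eq hw t₀)

/-- With the frequency frozen, the differential is `(A' / w) γ dt + A γ' dm`. The cross term drops
out because a curve on a sphere is orthogonal to its velocity. -/
theorem hasNormEnergy_oscillatingCurve (hγ : IsUnitSphereCurve γ) (hA : ContDiff ℝ ∞ A)
    (hw : ∀ t₀, ∀ᶠ t in 𝓝 t₀, A t = 0 ∨ w t = w t₀) (hpos : ∀ t, 0 < w t) (m : Fin 3) :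
    HasNormEnergy (oscillatingCurve γ A w m) (fun q => (A (q 0) / w (q 0)) ^ 2)
      (fun q v => (deriv A (q 0) / w (q 0)) ^ 2 * v 0 ^ 2 + A (q 0) ^ 2 * v m ^ 2) := by
  have hev : ∀ q₀ : Sol3, oscillatingCurve γ A w m =ᶠ[𝓝 q₀]
      fun q i => A (q 0) / w (q₀ 0) * γ (w (q₀ 0) * q m) i := fun q₀ => by
    filter_upwards [(continuous_apply (0 : Fin 3)).continuousAt.eventually (hw (q₀ 0))] with q hq
    ext i
    rcases hq with h | h <;> simp [oscillatingCurve, h]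
  have hcoord : ∀ (c : ℝ) (i : ι), ContDiff ℝ ∞ fun q : Sol3 => A (q 0) / c * γ (c * q m) i :=
    fun c i => ((hA.comp (contDiff_apply ℝ ℝ 0)).div_const c).mul
      ((contDiff_pi.1 hγ.smooth i).comp (contDiff_const.mul (contDiff_apply ℝ ℝ m)))
  have hs : ContDiff ℝ ∞ (oscillatingCurve γ A w m) := contDiff_iff_contDiffAt.2 fun q =>
    (contDiff_pi.2 (hcoord (w (q 0)))).contDiffAt.congr_of_eventuallyEq (hev q)
  refine ⟨hs, fun q => ?_, fun q v => ?_⟩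
  · simp only [oscillatingCurve, mul_pow, ← Finset.mul_sum, hγ.norm, mul_one]
  · set c := w (q 0) with hc
    have hc0 : c ≠ 0 := (hpos _).ne'
    have hd : ∀ i, fderiv ℝ (oscillatingCurve γ A w m) q v i =
        (deriv A (q 0) / c * v 0) * γ (c * q m) i + A (q 0) * v m * deriv γ (c * q m) i := by
      intro i
      have h1 : HasFDerivAt (fun q : Sol3 => A (q 0) / c)
          ((deriv A (q 0) / c) • ContinuousLinearMap.proj (R := ℝ) (φ := fun _ : Fin 3 => ℝ) 0) q :=
        HasDerivAt.comp_hasFDerivAt (f := fun q : Sol3 => q 0) q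
          ((hA.differentiable (by simp) (q 0)).hasDerivAt.div_const c) (hasFDerivAt_apply 0 q)
      have h2 : HasFDerivAt (fun q : Sol3 => γ (c * q m) i)
          (deriv γ (c * q m) i •
            (c • ContinuousLinearMap.proj (R := ℝ) (φ := fun _ : Fin 3 => ℝ) m)) q :=
        HasDerivAt.comp_hasFDerivAt (f := fun q : Sol3 => c * q m) q
          (hγ.hasDerivAt (c * q m) i) (HasFDerivAt.const_mul (hasFDerivAt_apply m q) c)
      rw [fderiv_apply_coord hs, ((h1.mul h2).congr_of_eventuallyEq
        ((hev q).mono fun q' h => congrFun h i)).fderiv]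
      simp
      field_simp
      ring
    simp only [hd, add_sq, mul_pow, Finset.sum_add_distrib, ← Finset.mul_sum, hγ.norm, hγ.speed]
    have h0 : ∑ i, 2 * (deriv A (q 0) / c * v 0 * γ (c * q m) i) *
        (A (q 0) * v m * deriv γ (c * q m) i) = 0 := by
      rw [← mul_zero (2 * (deriv A (q 0) / c * v 0) * (A (q 0) * v m)),
        ← hγ.orthogonal (c * q m), Finset.mul_sum]
      exact Finset.sum_congr rfl fun _ _ => by ring
    rw [h0]
    ring

end Oscillation

/-! ### Warped blocks -/

/-- A map depending only on `t` and the coordinate `m` that realizes the metric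
`K dt² + f² dm²` in Euclidean space, with `K`, its squared norm `n` and `n'` bounded by `ε`. -/
structure IsWarpedBlock {κ : Type*} [Fintype κ] (m : Fin 3) (f : ℝ → ℝ) (ε : ℝ)
    (X : Sol3 → κ → ℝ) (n K : ℝ → ℝ) : Prop where
  normEnergy : HasNormEnergy X (fun q => n (q 0))
    (fun q v => K (q 0) * v 0 ^ 2 + f (q 0) ^ 2 * v m ^ 2)
  smooth_norm : ContDiff ℝ ∞ n
  smooth_energy : ContDiff ℝ ∞ K
  norm_nonneg : ∀ t, 0 ≤ n t
  norm_le : ∀ t, n t ≤ ε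
  energy_le : ∀ t, K t ≤ ε
  abs_deriv_le : ∀ t, |deriv n t| ≤ ε
  congr : ∀ q q' : Sol3, q 0 = q' 0 → q m = q' m → X q = X q'

/-- The coordinate `m` is a continuous function of `t` and `X`. -/
def DeterminesCoord {κ : Type*} (m : Fin 3) (X : Sol3 → κ → ℝ) : Prop :=
  ∀ (l : Filter Sol3) (q : Sol3), Tendsto (fun p => p 0) l (𝓝 (q 0)) →
    Tendsto X l (𝓝 (X q)) → Tendsto (fun p => p m) l (𝓝 (q m))

/-- On some level of `t`, the map `X` is periodic in the coordinate `m`. -/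
def HasPeriodicLevel {κ : Type*} (m : Fin 3) (X : Sol3 → κ → ℝ) : Prop :=
  ∃ t h : ℝ, h ≠ 0 ∧ ∀ q : Sol3, q 0 = t → X (update q m (q m + h)) = X q

theorem exists_isWarpedBlock {ι : Type*} [Fintype ι] {γ : ℝ → ι → ℝ}
    (hγ : IsUnitSphereCurve γ) {m : Fin 3} (hm : m ≠ 0) {f : ℝ → ℝ} (hf : ContDiff ℝ ∞ f)
    (hf0 : ∀ t, f t ≠ 0) {ε : ℝ} (hε : 0 < ε) :
    ∃ (X : Sol3 → ι ⊕ ι → ℝ) (n K : ℝ → ℝ), IsWarpedBlock m f ε X n K ∧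
      (IsInducing γ → DeterminesCoord m X) ∧
      (Periodic γ (2 * Real.pi) → HasPeriodicLevel m X) := by
  obtain ⟨a, has, hsum, ⟨t₁, ht₁⟩, hfreq⟩ := exists_amplitudes
  obtain ⟨A, hA⟩ : ∃ A : Fin 2 → ℝ → ℝ, ∀ i t, A i t = f t * a i t := ⟨_, fun _ _ => rfl⟩
  have hAs : ∀ i, ContDiff ℝ ∞ (A i) := fun i => by
    rw [show A i = fun t => f t * a i t from funext (hA i)]
    exact hf.mul (has i)
  -- `δ` will bound each `A / w` and `A' / w`. The norm and `K` are then at most `2δ²`, and `|n'|`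
  -- is at most `4δ²`.
  obtain ⟨δ, hδ0, hδ⟩ : ∃ δ : ℝ, 0 < δ ∧ 4 * δ ^ 2 ≤ ε := by
    refine ⟨√(ε / 4), by positivity, ?_⟩
    rw [Real.sq_sqrt (by positivity)]; linarith
  have hex : ∀ i, ∃ w : ℝ → ℝ, (∀ t, (|A i t| + |deriv (A i) t|) / δ ≤ w t) ∧ (∀ t, 0 < w t) ∧
      ∀ t₀, ∀ᶠ t in 𝓝 t₀, A i t = 0 ∨ w t = w t₀ := fun i => by
    have hc : Continuous fun t => (|A i t| + |deriv (A i) t|) / δ :=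
      ((hAs i).continuous.abs.add ((hAs i).continuous_deriv (by simp)).abs).div_const δ
    obtain ⟨w, h1, h2, h3⟩ := hfreq _ hc i
    exact ⟨w, h1, h2, fun t₀ => (h3 t₀).mono fun t h => h.imp_left fun h => by simp [hA, h]⟩
  choose w hw1 hw2 hw3 using hex
  have hb : ∀ i t, |A i t / w i t| ≤ δ ∧ |deriv (A i) t / w i t| ≤ δ := fun i t => by
    have h := (div_le_iff₀ hδ0).1 (hw1 i t)
    rw [abs_div, abs_div, abs_of_pos (hw2 i t), div_le_iff₀ (hw2 i t), div_le_iff₀ (hw2 i t)]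
    have h1 := abs_nonneg (A i t)
    have h2 := abs_nonneg (deriv (A i) t)
    constructor <;> linarith
  have hdd : ∀ i, deriv (fun t => A i t / w i t) = fun t => deriv (A i) t / w i t := fun i =>
    funext fun t => (hasDerivAt_div_step (hAs i) (hw3 i) t).deriv
  have hBs : ∀ i, ContDiff ℝ ∞ fun t => A i t / w i t := fun i =>
    contDiff_div_step (hAs i) (hw3 i)
  have hBs' : ∀ i, ContDiff ℝ ∞ fun t => deriv (A i) t / w i t := fun i => by
    rw [← hdd]; exact (contDiff_infty_iff_deriv.1 (hBs i)).2
  have hn : ∀ t, HasDerivAt (fun t => (A 0 t / w 0 t) ^ 2 + (A 1 t / w 1 t) ^ 2)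
      (2 * (A 0 t / w 0 t) * (deriv (A 0) t / w 0 t) +
        2 * (A 1 t / w 1 t) * (deriv (A 1) t / w 1 t)) t := fun t => by
    have h := fun i => (hasDerivAt_div_step (hAs i) (hw3 i) t).fun_pow 2
    simpa using (h 0).fun_add (h 1)
  refine ⟨fun q => Sum.elim (oscillatingCurve γ (A 0) (w 0) m q) (oscillatingCurve γ (A 1) (w 1) m q),
    fun t => (A 0 t / w 0 t) ^ 2 + (A 1 t / w 1 t) ^ 2,
    fun t => (deriv (A 0) t / w 0 t) ^ 2 + (deriv (A 1) t / w 1 t) ^ 2, ?_, ?_, ?_⟩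
  · have hsq : ∀ i t, (A i t / w i t) ^ 2 ≤ δ ^ 2 ∧ (deriv (A i) t / w i t) ^ 2 ≤ δ ^ 2 :=
      fun i t => ⟨sq_le_sq' (abs_le.1 (hb i t).1).1 (abs_le.1 (hb i t).1).2,
        sq_le_sq' (abs_le.1 (hb i t).2).1 (abs_le.1 (hb i t).2).2⟩
    refine ⟨?_, ((hBs 0).pow 2).add ((hBs 1).pow 2), ((hBs' 0).pow 2).add ((hBs' 1).pow 2),
      fun t => by positivity, fun t => ?_, fun t => ?_, fun t => ?_, fun q q' h h' => ?_⟩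
    · have h := (hasNormEnergy_oscillatingCurve hγ (hAs 0) (hw3 0) (hw2 0) m).sumElim
        (hasNormEnergy_oscillatingCurve hγ (hAs 1) (hw3 1) (hw2 1) m)
      refine ⟨h.smooth, h.norm, fun q v => (h.energy q v).trans ?_⟩
      simp only [hA]
      linear_combination (f (q 0) ^ 2 * v m ^ 2) * hsum (q 0)
    · linarith [(hsq 0 t).1, (hsq 1 t).1]
    · linarith [(hsq 0 t).2, (hsq 1 t).2]
    · rw [(hn t).deriv]
      have h := fun i => hsq i t
      rw [abs_le]
      constructor
      · nlinarith [sq_nonneg (A 0 t / w 0 t + deriv (A 0) t / w 0 t), h 0, h 1,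
          sq_nonneg (A 1 t / w 1 t + deriv (A 1) t / w 1 t)]
      · nlinarith [sq_nonneg (A 0 t / w 0 t - deriv (A 0) t / w 0 t), h 0, h 1,
          sq_nonneg (A 1 t / w 1 t - deriv (A 1) t / w 1 t)]
    · ext (i | i) <;> simp only [Sum.elim_inl, Sum.elim_inr, oscillatingCurve, h, h']
  · intro hind l q h0 hX
    -- Where amplitude `i` is nonzero its frequency is locally constant, so dividing by the radius
    -- gives convergence of `γ (w y)`, and an inducing `γ` yields convergence of `y`. At every `t`
    -- at least one amplitude is nonzero.
    have key : ∀ i, a i (q 0) ≠ 0 → Tendsto (oscillatingCurve γ (A i) (w i) m) l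
        (𝓝 (oscillatingCurve γ (A i) (w i) m q)) → Tendsto (fun p => p m) l (𝓝 (q m)) := by
      intro i hi hosc
      have hAi : A i (q 0) ≠ 0 := hA i _ ▸ mul_ne_zero (hf0 _) hi
      have hev : ∀ᶠ t in 𝓝 (q 0), A i t ≠ 0 ∧ w i t = w i (q 0) := by
        filter_upwards [hw3 i (q 0), (hAs i).continuous.continuousAt.eventually_ne hAi]
          with t h1 h2 using ⟨h2, h1.resolve_left h2⟩
      have hB : Tendsto (fun p : Sol3 => A i (p 0) / w i (p 0)) l (𝓝 (A i (q 0) / w i (q 0))) :=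
        ((hBs i).continuous.tendsto (q 0)).comp h0
      have hγt : Tendsto (fun p : Sol3 => γ (w i (q 0) * p m)) l (𝓝 (γ (w i (q 0) * q m))) := by
        have h := (hB.inv₀ (div_ne_zero hAi (hw2 i _).ne')).smul hosc
        have e1 : ∀ p : Sol3, A i (p 0) ≠ 0 →
            (A i (p 0) / w i (p 0))⁻¹ • oscillatingCurve γ (A i) (w i) m p =
              γ (w i (p 0) * p m) := fun p hp => by
          ext j
          simp only [oscillatingCurve, Pi.smul_apply, smul_eq_mul]
          exact inv_mul_cancel_left₀ (div_ne_zero hp (hw2 i _).ne') _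
        rw [e1 q hAi] at h
        refine h.congr' ?_
        filter_upwards [h0.eventually hev] with p hp
        rw [e1 p hp.1, hp.2]
      have h1 := (hind.tendsto_nhds_iff (f := fun p : Sol3 => w i (q 0) * p m)).2 hγt
      have h2 := h1.const_mul (w i (q 0))⁻¹
      simpa only [inv_mul_cancel_left₀ (hw2 i (q 0)).ne'] using h2
    rw [tendsto_pi_nhds] at hX
    by_cases h : a 0 (q 0) = 0
    · refine key 1 (fun h' => ?_) (tendsto_pi_nhds.2 fun i => hX (.inr i))
      have := hsum (q 0)
      simp [h, h'] at this
    · exact key 0 h (tendsto_pi_nhds.2 fun i => hX (.inl i))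
  · intro hper
    -- At `t₁` the second amplitude vanishes, so only one frequency is present and its period is a
    -- period of the whole block.
    refine ⟨t₁, 2 * Real.pi / w 0 t₁, div_ne_zero (by positivity) (hw2 0 t₁).ne', ?_⟩
    rintro q rfl
    have hw0 := (hw2 0 (q 0)).ne'
    ext (i | i)
    · simp only [Sum.elim_inl, oscillatingCurve, update_self, update_of_ne hm.symm]
      rw [mul_add, mul_div_cancel₀ _ hw0, hper]
    · simp [oscillatingCurve, update_of_ne hm.symm, hA, ht₁]

/-! ### Recovering coordinates by limits; maps depending on `t` -/

theorem isInducing_of_tendsto {X Y : Type*} [TopologicalSpace X] [TopologicalSpace Y] {F : X → Y}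
    (hc : Continuous F) (h : ∀ (l : Filter X) (q : X), Tendsto F l (𝓝 (F q)) → l ≤ 𝓝 q) :
    IsInducing F :=
  isInducing_iff_nhds.2 fun q =>
    le_antisymm (hc.tendsto q).le_comap (h _ q tendsto_comap)

theorem le_nhds_sol3 {l : Filter Sol3} {q : Sol3} (h0 : Tendsto (fun p : Sol3 => p 0) l (𝓝 (q 0)))
    (h1 : Tendsto (fun p : Sol3 => p 1) l (𝓝 (q 1)))
    (h2 : Tendsto (fun p : Sol3 => p 2) l (𝓝 (q 2))) : l ≤ 𝓝 q := by
  have : Tendsto (fun p : Sol3 => p) l (𝓝 q) := tendsto_pi_nhds.2 fun i => by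
    fin_cases i
    · exact h0
    · exact h1
    · exact h2
  exact this

theorem solMetric_self (q v : Sol3) : solMetric q v v =
    v 0 ^ 2 + Real.exp (q 0) ^ 2 * v 1 ^ 2 + Real.exp (-q 0) ^ 2 * v 2 ^ 2 := by
  simp only [solMetric, ← Real.exp_nat_mul]
  push_cast
  ring_nf

theorem hasFDerivAt_time {φ φ' : ℝ → ℝ} (h : ∀ t, HasDerivAt φ (φ' t) t) (q : Sol3) :
    HasFDerivAt (fun q : Sol3 => φ (q 0))
      (φ' (q 0) • ContinuousLinearMap.proj (R := ℝ) (φ := fun _ : Fin 3 => ℝ) 0) q :=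
  HasDerivAt.comp_hasFDerivAt (f := fun q : Sol3 => q 0) q (h (q 0)) (hasFDerivAt_apply 0 q)

theorem HasNormEnergy.of_time {φ φ' : ℝ → ℝ} (hs : ContDiff ℝ ∞ φ)
    (h : ∀ t, HasDerivAt φ (φ' t) t) :
    HasNormEnergy (fun q (_ : Unit) => φ (q 0)) (fun q => φ (q 0) ^ 2)
      (fun q v => (φ' (q 0) * v 0) ^ 2) :=
  HasNormEnergy.of_scalar (hs.comp (contDiff_apply ℝ ℝ 0)) fun q v => by
    rw [(hasFDerivAt_time h q).fderiv]; simp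

theorem HasNormEnergy.of_time_curve {ι : Type*} [Fintype ι] {γ : ℝ → ι → ℝ}
    (hγ : IsUnitSphereCurve γ) {ρ ρ' θ θ' : ℝ → ℝ} (hρ : ContDiff ℝ ∞ ρ) (hθ : ContDiff ℝ ∞ θ)
    (hρd : ∀ t, HasDerivAt ρ (ρ' t) t) (hθd : ∀ t, HasDerivAt θ (θ' t) t) :
    HasNormEnergy (fun q i => ρ (q 0) * γ (θ (q 0)) i) (fun q => ρ (q 0) ^ 2)
      (fun q v => (ρ' (q 0) ^ 2 + ρ (q 0) ^ 2 * θ' (q 0) ^ 2) * v 0 ^ 2) := by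
  have hs : ContDiff ℝ ∞ (fun (q : Sol3) i => ρ (q 0) * γ (θ (q 0)) i) :=
    contDiff_pi.2 fun i => (hρ.mul ((contDiff_pi.1 hγ.smooth i).comp hθ)).comp
      (contDiff_apply ℝ ℝ 0)
  refine ⟨hs, fun q => ?_, fun q v => ?_⟩
  · simp only [mul_pow, ← Finset.mul_sum, hγ.norm, mul_one]
  · have hd : ∀ i, fderiv ℝ (fun (q : Sol3) i => ρ (q 0) * γ (θ (q 0)) i) q v i =
        ρ' (q 0) * v 0 * γ (θ (q 0)) i + ρ (q 0) * θ' (q 0) * v 0 * deriv γ (θ (q 0)) i := by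
      intro i
      have h := hasFDerivAt_time (φ := fun t => ρ t * γ (θ t) i)
        (fun t => (hρd t).mul ((hγ.hasDerivAt (θ t) i).comp t (hθd t))) q
      rw [fderiv_apply_coord hs, h.fderiv]
      simp
      ring
    simp only [hd, add_sq, mul_pow, Finset.sum_add_distrib, ← Finset.mul_sum, hγ.norm, hγ.speed]
    have h0 : ∑ i, 2 * (ρ' (q 0) * v 0 * γ (θ (q 0)) i) *
        (ρ (q 0) * θ' (q 0) * v 0 * deriv γ (θ (q 0)) i) = 0 := by
      rw [← mul_zero (2 * (ρ' (q 0) * v 0) * (ρ (q 0) * θ' (q 0) * v 0)),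
        ← hγ.orthogonal (θ (q 0)), Finset.mul_sum]
      exact Finset.sum_congr rfl fun _ _ => by ring
    rw [h0]
    ring

theorem HasPeriodicLevel.exists_ne {κ : Type*} {m : Fin 3} {X : Sol3 → κ → ℝ}
    (h : HasPeriodicLevel m X) :
    ∃ q q' : Sol3, q ≠ q' ∧ (∀ i, i ≠ m → q i = q' i) ∧ X q = X q' := by
  obtain ⟨t, h, hh, hX⟩ := h
  refine ⟨update 0 0 t, update (update 0 0 t) m (update (0 : Sol3) 0 t m + h), ?_, ?_, ?_⟩
  · intro heq
    have := congrFun heq m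
    rw [update_self] at this
    exact hh (by linarith)
  · intro i hi; rw [update_of_ne hi]
  · exact (hX _ (by simp)).symm

/-- Two warped blocks realizing `dx²` and `dy²` in the metric of `Sol₃`. -/
theorem exists_solBlock {ι : Type*} [Fintype ι] {γ : ℝ → ι → ℝ} (hγ : IsUnitSphereCurve γ)
    {ε : ℝ} (hε : 0 < ε) :
    ∃ (W : Sol3 → (ι ⊕ ι) ⊕ (ι ⊕ ι) → ℝ) (n K : ℝ → ℝ),
      HasNormEnergy W (fun q => n (q 0))
        (fun q v => (K (q 0) - 1) * v 0 ^ 2 + solMetric q v v) ∧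
      ContDiff ℝ ∞ n ∧ ContDiff ℝ ∞ K ∧ (∀ t, 0 ≤ n t ∧ n t ≤ ε) ∧ (∀ t, K t ≤ ε) ∧
      (∀ t, |deriv n t| ≤ ε) ∧
      (IsInducing γ → ∀ (l : Filter Sol3) (q : Sol3), Tendsto (fun p => p 0) l (𝓝 (q 0)) →
        Tendsto W l (𝓝 (W q)) → l ≤ 𝓝 q) ∧
      (Periodic γ (2 * Real.pi) → ∃ q q' : Sol3, q ≠ q' ∧ q 0 = q' 0 ∧ W q = W q') := by
  obtain ⟨X, n, K, hX, hXi, -⟩ := exists_isWarpedBlock hγ (m := 1) (by simp)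
    Real.contDiff_exp (fun t => (Real.exp_pos t).ne') (half_pos hε)
  obtain ⟨Y, n', K', hY, hYi, hYp⟩ := exists_isWarpedBlock hγ (m := 2) (by simp)
    (Real.contDiff_exp.comp contDiff_neg) (fun t => (Real.exp_pos (-t)).ne') (half_pos hε)
  refine ⟨fun q => Sum.elim (X q) (Y q), fun t => n t + n' t, fun t => K t + K' t, ?_,
    hX.smooth_norm.add hY.smooth_norm, hX.smooth_energy.add hY.smooth_energy, fun t => ?_,
    fun t => ?_, fun t => ?_, fun hi l q h0 hW => ?_, fun hp => ?_⟩
  · have h := hX.normEnergy.sumElim hY.normEnergy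
    refine ⟨h.smooth, h.norm, fun q v => (h.energy q v).trans ?_⟩
    simp only [solMetric_self, comp_apply]
    ring
  · exact ⟨add_nonneg (hX.norm_nonneg t) (hY.norm_nonneg t),
      by linarith [hX.norm_le t, hY.norm_le t]⟩
  · linarith [hX.energy_le t, hY.energy_le t]
  · rw [deriv_fun_add (hX.smooth_norm.differentiable (by simp) t)
      (hY.smooth_norm.differentiable (by simp) t)]
    exact (abs_add_le _ _).trans (by linarith [hX.abs_deriv_le t, hY.abs_deriv_le t])
  · rw [tendsto_pi_nhds] at hW
    exact le_nhds_sol3 h0 (hXi hi l q h0 (tendsto_pi_nhds.2 fun i => hW (.inl i)))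
      (hYi hi l q h0 (tendsto_pi_nhds.2 fun i => hW (.inr i)))
  · obtain ⟨q, q', hne, hq, hYq⟩ := (hYp hp).exists_ne
    exact ⟨q, q', hne, hq 0 (by simp), by
      simp only [hX.congr q q' (hq 0 (by simp)) (hq 1 (by simp)), hYq]⟩

/-! ### Euclidean, hyperbolic and spherical targets -/

theorem exists_euclidean_pair {ι : Type*} [Fintype ι] {γ : ℝ → ι → ℝ} (hγ : IsUnitSphereCurve γ) :
    ∃ (F : Sol3 → Empty → ℝ) (G : Sol3 → ((ι ⊕ ι) ⊕ (ι ⊕ ι)) ⊕ Unit → ℝ),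
      IsIsometricPair F G ∧ (IsInducing γ → IsInducing fun q => (F q, G q)) ∧
      (Periodic γ (2 * Real.pi) → ∃ q q' : Sol3, q ≠ q' ∧ G q = G q') := by
  obtain ⟨W, n, K, hW, -, hK, -, hK1, -, hind, hper⟩ := exists_solBlock hγ (ε := 1 / 2) (by norm_num)
  have hpos : ∀ t, 0 < 1 - K t := fun t => by linarith [hK1 t]
  -- The last coordinate supplies the missing `(1 - K) dt²`; as it is strictly increasing, it also
  -- determines `t`.
  obtain ⟨Φ, hΦ, hΦd⟩ := exists_smooth_antideriv
    ((contDiff_const (c := (1 : ℝ)).sub hK).sqrt fun t => (hpos t).ne')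
  have hG := hW.sumElim (HasNormEnergy.of_time hΦ hΦd)
  refine ⟨fun _ i => i.elim, fun q => Sum.elim (W q) fun _ => Φ (q 0),
    HasNormEnergy.empty.isIsometricPair hG fun q v => ?_, fun hi => ?_, fun hp => ?_⟩
  · rw [mul_pow, Real.sq_sqrt (hpos _).le]; ring
  · refine isInducing_of_tendsto (continuous_const.prodMk hG.smooth.continuous) fun l q h => ?_
    have h2 := tendsto_pi_nhds.1 h.snd_nhds
    exact hind hi l q ((isInducing_of_hasDerivAt_pos hΦd fun t => Real.sqrt_pos.2
      (hpos t)).tendsto_nhds_iff.2 (h2 (.inr ()))) (tendsto_pi_nhds.2 fun i => h2 (.inl i))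
  · obtain ⟨q, q', hne, h0, h⟩ := hper hp
    exact ⟨q, q', hne, by simp only [h0, h]⟩

/-- The block is completed by `(ρ cosh θ, ρ sinh θ)`. The quadric equation forces `ρ² = 1/c + n`,
and the metric forces `ρ² θ'² = 1 - K + ρ'²`, which is positive. -/
theorem exists_hyperbolic_pair {ι : Type*} [Fintype ι] {γ : ℝ → ι → ℝ} (hγ : IsUnitSphereCurve γ)
    {c : ℝ} (hc : 0 < c) :
    ∃ (F : Sol3 → Unit → ℝ) (G : Sol3 → ((ι ⊕ ι) ⊕ (ι ⊕ ι)) ⊕ Unit → ℝ),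
      IsIsometricPair F G ∧ (∀ q, -∑ i, F q i ^ 2 + ∑ i, G q i ^ 2 = -(1 / c)) ∧
      (∀ q i, 0 < F q i) ∧ (IsInducing γ → IsInducing fun q => (F q, G q)) ∧
      (Periodic γ (2 * Real.pi) → ∃ q q' : Sol3, q ≠ q' ∧ F q = F q' ∧ G q = G q') := by
  obtain ⟨W, n, K, hW, hn, hK, hn0, hK1, -, hind, hper⟩ :=
    exists_solBlock hγ (ε := 1 / 2) (by norm_num)
  have hpos : ∀ t, 0 < 1 / c + n t := fun t => by have := (hn0 t).1; positivity
  obtain ⟨ρ, hρ⟩ : ∃ ρ : ℝ → ℝ, ρ = fun t => √(1 / c + n t) := ⟨_, rfl⟩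
  have hρs : ContDiff ℝ ∞ ρ := by
    rw [hρ]; exact (contDiff_const.add hn).sqrt fun t => (hpos t).ne'
  have hρ0 : ∀ t, 0 < ρ t := fun t => by rw [hρ]; exact Real.sqrt_pos.2 (hpos t)
  have hρsq : ∀ t, ρ t ^ 2 = 1 / c + n t := fun t => by rw [hρ]; exact Real.sq_sqrt (hpos t).le
  have hρd : ∀ t, HasDerivAt ρ (deriv ρ t) t := fun t =>
    (hρs.differentiable (by simp) t).hasDerivAt
  have hρ's : ContDiff ℝ ∞ (deriv ρ) := (contDiff_infty_iff_deriv.1 hρs).2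
  have hh : ∀ t, 0 < 1 - K t + deriv ρ t ^ 2 := fun t => by
    have := hK1 t; have := sq_nonneg (deriv ρ t); linarith
  obtain ⟨θ, hθ, hθd⟩ : ∃ θ : ℝ → ℝ, ContDiff ℝ ∞ θ ∧
      ∀ t, HasDerivAt θ (√(1 - K t + deriv ρ t ^ 2) / ρ t) t := exists_smooth_antideriv
    ((((contDiff_const (c := (1 : ℝ)).sub hK).add (hρ's.pow 2)).sqrt fun t => (hh t).ne').div hρs
      fun t => (hρ0 t).ne')
  have hF := HasNormEnergy.of_time (φ := fun t => ρ t * Real.cosh (θ t)) (hρs.mul (Real.contDiff_cosh.comp hθ))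
    fun t => (hρd t).mul (hθd t).cosh
  have hG := hW.sumElim (HasNormEnergy.of_time (φ := fun t => ρ t * Real.sinh (θ t))
    (hρs.mul (Real.contDiff_sinh.comp hθ))
    fun t => (hρd t).mul (hθd t).sinh)
  have hcs : ∀ t, Real.cosh (θ t) ^ 2 - Real.sinh (θ t) ^ 2 = 1 := fun t =>
    Real.cosh_sq_sub_sinh_sq _
  refine ⟨fun q _ => ρ (q 0) * Real.cosh (θ (q 0)),
    fun q => Sum.elim (W q) fun _ => ρ (q 0) * Real.sinh (θ (q 0)),
    hF.isIsometricPair hG fun q v => ?_, fun q => ?_,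
    fun q _ => mul_pos (hρ0 _) (Real.cosh_pos _), fun hi => ?_, fun hp => ?_⟩
  · have h1 : (ρ (q 0) * (√(1 - K (q 0) + deriv ρ (q 0) ^ 2) / ρ (q 0))) ^ 2 =
        1 - K (q 0) + deriv ρ (q 0) ^ 2 := by
      rw [mul_div_cancel₀ _ (hρ0 _).ne', Real.sq_sqrt (hh _).le]
    generalize √(1 - K (q 0) + deriv ρ (q 0) ^ 2) / ρ (q 0) = θ' at *
    linear_combination ((ρ (q 0) * θ') ^ 2 - deriv ρ (q 0) ^ 2) * v 0 ^ 2 * hcs (q 0) +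
      v 0 ^ 2 * h1
  · have e1 := hF.norm q
    have e2 := hG.norm q
    beta_reduce at e1 e2 ⊢
    rw [e1, e2]
    linear_combination -(ρ (q 0) ^ 2) * hcs (q 0) - hρsq (q 0)
  · refine isInducing_of_tendsto (hF.smooth.continuous.prodMk hG.smooth.continuous) fun l q h => ?_
    have h1 := tendsto_pi_nhds.1 h.fst_nhds ()
    have h2 := tendsto_pi_nhds.1 h.snd_nhds
    have h3 := h2 (.inr ())
    simp only [Sum.elim_inr] at h3
    have hr : Tendsto (fun p : Sol3 => ρ (p 0)) l (𝓝 (ρ (q 0))) := by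
      have h4 := ((h1.pow 2).sub (h3.pow 2)).sqrt
      have e : ∀ p : Sol3, √((ρ (p 0) * Real.cosh (θ (p 0))) ^ 2 -
          (ρ (p 0) * Real.sinh (θ (p 0))) ^ 2) = ρ (p 0) := fun p => by
        rw [mul_pow, mul_pow, ← mul_sub, hcs, mul_one, Real.sqrt_sq (hρ0 _).le]
      simpa only [e] using h4
    have ht : Tendsto (fun p : Sol3 => θ (p 0)) l (𝓝 (θ (q 0))) := by
      have h4 := (Real.continuous_arsinh.tendsto _).comp (h3.div hr (hρ0 _).ne')
      simpa only [comp_def, Pi.div_apply, mul_div_cancel_left₀ _ (hρ0 _).ne', Real.arsinh_sinh]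
        using h4
    exact hind hi l q ((isInducing_of_hasDerivAt_pos hθd fun t => div_pos (Real.sqrt_pos.2
      (hh t)) (hρ0 t)).tendsto_nhds_iff.2 ht) (tendsto_pi_nhds.2 fun i => h2 (.inl i))
  · obtain ⟨q, q', hne, h0, h⟩ := hper hp
    exact ⟨q, q', hne, by simp only [h0], by simp only [h0, h]⟩

/-- The block is completed by `ρ γ(θ)` with `ρ² = 1/c - n`. Now `ρ² θ'² = 1 - K - ρ'²`, so `ρ'` must
be small too; this is what the bound on `n'` serves. -/
theorem exists_spherical_pair {ι : Type*} [Fintype ι] {γ : ℝ → ι → ℝ} (hγ : IsUnitSphereCurve γ)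
    {c : ℝ} (hc : 0 < c) :
    ∃ (F : Sol3 → Empty → ℝ) (G : Sol3 → ((ι ⊕ ι) ⊕ (ι ⊕ ι)) ⊕ ι → ℝ),
      IsIsometricPair F G ∧ (∀ q, -∑ i, F q i ^ 2 + ∑ i, G q i ^ 2 = 1 / c) ∧
      (IsInducing γ → IsInducing fun q => (F q, G q)) ∧
      (Periodic γ (2 * Real.pi) → ∃ q q' : Sol3, q ≠ q' ∧ G q = G q') := by
  -- `ε ≤ 1/(2c)` gives `ρ² ≥ ε`. From `2ρρ' = -n'` then follows `ρ'² ≤ ε/4`, and `ε ≤ 1/4` keeps `1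
  -- - K - ρ'²` positive.
  obtain ⟨ε, hε0, hε1, hε2⟩ : ∃ ε : ℝ, 0 < ε ∧ ε ≤ 1 / 4 ∧ ε ≤ 1 / c / 2 :=
    ⟨min (1 / 4) (1 / c / 2), by positivity, min_le_left _ _, min_le_right _ _⟩
  obtain ⟨W, n, K, hW, hn, hK, hn0, hK1, hn', hind, hper⟩ := exists_solBlock hγ hε0
  have hlow : ∀ t, ε ≤ 1 / c - n t := fun t => by have := (hn0 t).2; linarith
  have hpos : ∀ t, 0 < 1 / c - n t := fun t => hε0.trans_le (hlow t)
  obtain ⟨ρ, hρ⟩ : ∃ ρ : ℝ → ℝ, ρ = fun t => √(1 / c - n t) := ⟨_, rfl⟩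
  have hρs : ContDiff ℝ ∞ ρ := by
    rw [hρ]; exact (contDiff_const.sub hn).sqrt fun t => (hpos t).ne'
  have hρ0 : ∀ t, 0 < ρ t := fun t => by rw [hρ]; exact Real.sqrt_pos.2 (hpos t)
  have hρsq : ∀ t, ρ t ^ 2 = 1 / c - n t := fun t => by rw [hρ]; exact Real.sq_sqrt (hpos t).le
  have hρd : ∀ t, HasDerivAt ρ (deriv ρ t) t := fun t =>
    (hρs.differentiable (by simp) t).hasDerivAt
  have hρ's : ContDiff ℝ ∞ (deriv ρ) := (contDiff_infty_iff_deriv.1 hρs).2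
  have hρρ' : ∀ t, 2 * ρ t * deriv ρ t = -deriv n t := fun t => by
    have h1 : HasDerivAt (fun t => ρ t ^ 2) (-deriv n t) t := by
      simp only [hρsq]
      exact ((hn.differentiable (by simp) t).hasDerivAt).const_sub _
    have h2 := (hρd t).fun_pow 2
    simpa using h2.unique h1
  have hρ'le : ∀ t, deriv ρ t ^ 2 ≤ 1 / 4 := fun t => by
    have h1 : 4 * ρ t ^ 2 * deriv ρ t ^ 2 = deriv n t ^ 2 := by
      linear_combination (2 * ρ t * deriv ρ t - deriv n t) * hρρ' t
    have h2 : deriv n t ^ 2 ≤ ε ^ 2 := sq_le_sq' (abs_le.1 (hn' t)).1 (abs_le.1 (hn' t)).2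
    have h3 : ε ≤ ρ t ^ 2 := (hlow t).trans_eq (hρsq t).symm
    have h4 : 4 * ε * deriv ρ t ^ 2 ≤ ε * ε := by
      nlinarith [mul_le_mul_of_nonneg_right h3 (sq_nonneg (deriv ρ t))]
    have h5 : 4 * deriv ρ t ^ 2 ≤ ε := by
      by_contra! h
      nlinarith [mul_lt_mul_of_pos_left h hε0]
    linarith
  have hh : ∀ t, 0 < 1 - K t - deriv ρ t ^ 2 := fun t => by
    have := hK1 t; have := hρ'le t; linarith
  obtain ⟨θ, hθ, hθd⟩ : ∃ θ : ℝ → ℝ, ContDiff ℝ ∞ θ ∧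
      ∀ t, HasDerivAt θ (√(1 - K t - deriv ρ t ^ 2) / ρ t) t := exists_smooth_antideriv
    ((((contDiff_const (c := (1 : ℝ)).sub hK).sub (hρ's.pow 2)).sqrt fun t => (hh t).ne').div hρs
      fun t => (hρ0 t).ne')
  have hG := hW.sumElim (HasNormEnergy.of_time_curve hγ hρs hθ hρd hθd)
  refine ⟨fun _ i => i.elim, fun q => Sum.elim (W q) fun i => ρ (q 0) * γ (θ (q 0)) i,
    HasNormEnergy.empty.isIsometricPair hG fun q v => ?_, fun q => ?_, fun hi => ?_, fun hp => ?_⟩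
  · have h1 : ρ (q 0) ^ 2 * (√(1 - K (q 0) - deriv ρ (q 0) ^ 2) / ρ (q 0)) ^ 2 =
        1 - K (q 0) - deriv ρ (q 0) ^ 2 := by
      rw [← mul_pow, mul_div_cancel₀ _ (hρ0 _).ne', Real.sq_sqrt (hh _).le]
    linear_combination v 0 ^ 2 * h1
  · have e2 := hG.norm q
    beta_reduce at e2 ⊢
    rw [e2]
    simp [hρsq]
  · refine isInducing_of_tendsto (continuous_const.prodMk hG.smooth.continuous) fun l q h => ?_
    have h2 := tendsto_pi_nhds.1 h.snd_nhds
    have h3 : Tendsto (fun p : Sol3 => fun i => ρ (p 0) * γ (θ (p 0)) i) l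
      (𝓝 fun i => ρ (q 0) * γ (θ (q 0)) i) := tendsto_pi_nhds.2 fun i => h2 (.inr i)
    have hr : Tendsto (fun p : Sol3 => ρ (p 0)) l (𝓝 (ρ (q 0))) := by
      have h4 := (tendsto_finsetSum Finset.univ fun i _ => (tendsto_pi_nhds.1 h3 i).pow 2).sqrt
      have e : ∀ p : Sol3, √(∑ i, (ρ (p 0) * γ (θ (p 0)) i) ^ 2) = ρ (p 0) := fun p => by
        simp only [mul_pow, ← Finset.mul_sum, hγ.norm, mul_one, Real.sqrt_sq (hρ0 _).le]
      simpa only [e] using h4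
    have hg : Tendsto (fun p : Sol3 => γ (θ (p 0))) l (𝓝 (γ (θ (q 0)))) := by
      have h4 := (hr.inv₀ (hρ0 _).ne').smul h3
      have e : ∀ p : Sol3, ((ρ (p 0))⁻¹ • fun i => ρ (p 0) * γ (θ (p 0)) i) = γ (θ (p 0)) :=
        fun p => by ext i; simp [inv_mul_cancel_left₀ (hρ0 (p 0)).ne']
      simpa only [e] using h4
    have ht : Tendsto (fun p : Sol3 => θ (p 0)) l (𝓝 (θ (q 0))) := hi.tendsto_nhds_iff.2 hg
    exact hind hi l q ((isInducing_of_hasDerivAt_pos hθd fun t => div_pos (Real.sqrt_pos.2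
      (hh t)) (hρ0 t)).tendsto_nhds_iff.2 ht) (tendsto_pi_nhds.2 fun i => h2 (.inl i))
  · obtain ⟨q, q', hne, h0, h⟩ := hper hp
    exact ⟨q, q', hne, by simp only [h0, h]⟩

/-! ### The null surface -/

/-- The negative coordinate `(u + v) / 2` of the surface `u = eᵗ`, `v = eᵗ x² + φ(t)` with third
coordinate `eᵗ x`. -/
noncomputable def nullNeg (φ : ℝ → ℝ) (q : Sol3) (_ : Unit) : ℝ :=
  (Real.exp (q 0) + (Real.exp (q 0) * q 1 ^ 2 + φ (q 0))) / 2

/-- The positive coordinates `(u - v) / 2` and `eᵗ x` of the surface `u = eᵗ`,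
`v = eᵗ x² + φ(t)`. -/
noncomputable def nullPos (φ : ℝ → ℝ) (q : Sol3) : Unit ⊕ Unit → ℝ :=
  Sum.elim (fun _ => (Real.exp (q 0) - (Real.exp (q 0) * q 1 ^ 2 + φ (q 0))) / 2)
    fun _ => Real.exp (q 0) * q 1

section NullSurface

variable {φ φ' : ℝ → ℝ}

theorem hasNormEnergy_nullNeg (hs : ContDiff ℝ ∞ φ) (hd : ∀ t, HasDerivAt φ (φ' t) t) :
    HasNormEnergy (nullNeg φ)
      (fun q => ((Real.exp (q 0) + (Real.exp (q 0) * q 1 ^ 2 + φ (q 0))) / 2) ^ 2)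
      (fun q v => ((Real.exp (q 0) * v 0 + (Real.exp (q 0) * q 1 ^ 2 * v 0 +
        2 * Real.exp (q 0) * q 1 * v 1 + φ' (q 0) * v 0)) / 2) ^ 2) := by
  refine HasNormEnergy.of_scalar
    (g := fun q => (Real.exp (q 0) + (Real.exp (q 0) * q 1 ^ 2 + φ (q 0))) / 2) (by fun_prop)
    fun q v => ?_
  have he := hasFDerivAt_time Real.hasDerivAt_exp q
  have h1 : HasFDerivAt (fun q : Sol3 => q 1)
    (ContinuousLinearMap.proj (R := ℝ) (φ := fun _ : Fin 3 => ℝ) 1) q := hasFDerivAt_apply 1 q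
  have h2 : HasFDerivAt (fun q : Sol3 => q 1 ^ 2) _ q := HasFDerivAt.pow h1 2
  simp only [div_eq_mul_inv]
  rw [((he.fun_add ((he.fun_mul h2).fun_add
    (hasFDerivAt_time hd q))).mul_const 2⁻¹).fderiv]
  simp
  ring

theorem hasNormEnergy_nullPos (hs : ContDiff ℝ ∞ φ) (hd : ∀ t, HasDerivAt φ (φ' t) t) :
    HasNormEnergy (nullPos φ)
      (fun q => ((Real.exp (q 0) - (Real.exp (q 0) * q 1 ^ 2 + φ (q 0))) / 2) ^ 2 +
        (Real.exp (q 0) * q 1) ^ 2)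
      (fun q v => ((Real.exp (q 0) * v 0 - (Real.exp (q 0) * q 1 ^ 2 * v 0 +
        2 * Real.exp (q 0) * q 1 * v 1 + φ' (q 0) * v 0)) / 2) ^ 2 +
        (Real.exp (q 0) * q 1 * v 0 + Real.exp (q 0) * v 1) ^ 2) := by
  refine HasNormEnergy.sumElim (HasNormEnergy.of_scalar (by fun_prop) fun q v => ?_)
    (HasNormEnergy.of_scalar (by fun_prop) fun q v => ?_)
  all_goals
    have he := hasFDerivAt_time Real.hasDerivAt_exp q
    have h1 : HasFDerivAt (fun q : Sol3 => q 1)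
      (ContinuousLinearMap.proj (R := ℝ) (φ := fun _ : Fin 3 => ℝ) 1) q := hasFDerivAt_apply 1 q
  · have h2 : HasFDerivAt (fun q : Sol3 => q 1 ^ 2) _ q := HasFDerivAt.pow h1 2
    simp only [div_eq_mul_inv]
    rw [((he.fun_sub ((he.fun_mul h2).fun_add (hasFDerivAt_time hd q))).mul_const
      2⁻¹).fderiv]
    simp
    ring
  · rw [(he.fun_mul h1).fderiv]
    simp
    ring

variable {ι κ : Type*} [Fintype ι] [Fintype κ] {S : Sol3 → ι → ℝ} {R : Sol3 → κ → ℝ}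
  {nS nR : Sol3 → ℝ} {eS eR : Sol3 → Sol3 → ℝ}

/-- In `-du dv + dz²` the `x²dt²` and `x dt dx` terms cancel, leaving `e^{2t} dx² - eᵗ φ' dt²`. The
hypothesis is the balance left for the remaining coordinates. -/
theorem isIsometricPair_null (hs : ContDiff ℝ ∞ φ) (hd : ∀ t, HasDerivAt φ (φ' t) t)
    (hS : HasNormEnergy S nS eS) (hR : HasNormEnergy R nR eR)
    (h : ∀ q v, -eS q v + eR q v =
      (1 + Real.exp (q 0) * φ' (q 0)) * v 0 ^ 2 + Real.exp (-q 0) ^ 2 * v 2 ^ 2) :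
    IsIsometricPair (fun q => (Sum.elim (nullNeg φ q) (S q) : Unit ⊕ ι → ℝ))
      (fun q => (Sum.elim (nullPos φ q) (R q) : (Unit ⊕ Unit) ⊕ κ → ℝ)) := by
  refine ((hasNormEnergy_nullNeg hs hd).sumElim hS).isIsometricPair
    ((hasNormEnergy_nullPos hs hd).sumElim hR) fun q v => ?_
  rw [solMetric_self]
  linear_combination h q v

/-- The two null coordinates sum to `eᵗ`, which gives `t`; then `x` is `eᵗ x / eᵗ`, and `R` supplies
`y`. -/
theorem isInducing_null (hs : ContDiff ℝ ∞ φ) (hS : ContDiff ℝ ∞ S) (hR : ContDiff ℝ ∞ R)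
    (hdet : DeterminesCoord 2 R) :
    IsInducing fun q => ((Sum.elim (nullNeg φ q) (S q) : Unit ⊕ ι → ℝ),
      (Sum.elim (nullPos φ q) (R q) : (Unit ⊕ Unit) ⊕ κ → ℝ)) := by
  have hneg : ContDiff ℝ ∞ (nullNeg φ) := contDiff_pi.2 fun _ => by unfold nullNeg; fun_prop
  have hpos : ContDiff ℝ ∞ (nullPos φ) := contDiff_pi.2 fun i => by
    rcases i with i | i <;> simp only [nullPos, Sum.elim_inl, Sum.elim_inr] <;> fun_prop
  refine isInducing_of_tendsto ((hneg.sumElim hS).continuous.prodMk (hpos.sumElim hR).continuous)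
    fun l q h => ?_
  have h1 := tendsto_pi_nhds.1 h.fst_nhds (.inl ())
  have h2 := tendsto_pi_nhds.1 h.snd_nhds
  have h3 := h2 (.inl (.inl ()))
  have h4 := h2 (.inl (.inr ()))
  simp only [Sum.elim_inl, Sum.elim_inr, nullNeg, nullPos] at h1 h3 h4
  have hu : Tendsto (fun p : Sol3 => Real.exp (p 0)) l (𝓝 (Real.exp (q 0))) := by
    convert! h1.add h3 using 2 <;> ring
  have h0 : Tendsto (fun p : Sol3 => p 0) l (𝓝 (q 0)) := by
    simpa only [Real.log_exp] using hu.log (Real.exp_pos _).ne'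
  refine le_nhds_sol3 h0 ?_ (hdet l q h0 (tendsto_pi_nhds.2 fun i => h2 (.inr i)))
  have h5 : Tendsto (fun p : Sol3 => Real.exp (p 0) * p 1 / Real.exp (p 0)) l _ :=
    h4.div hu (Real.exp_pos _).ne'
  simpa only [mul_div_cancel_left₀ _ (Real.exp_pos _).ne'] using h5

end NullSurface

/-! ### Lorentz space, de Sitter and anti-de Sitter targets -/

theorem DeterminesCoord.sumElim {ι κ : Type*} {m : Fin 3} {Y : Sol3 → ι → ℝ}
    (h : DeterminesCoord m Y) (Z : Sol3 → κ → ℝ) :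
    DeterminesCoord m fun q => (Sum.elim (Y q) (Z q) : ι ⊕ κ → ℝ) := fun l q h0 hl =>
  h l q h0 (tendsto_pi_nhds.2 fun i => tendsto_pi_nhds.1 hl (.inl i))

theorem exists_warpedBlock_exp_neg {ι : Type*} [Fintype ι] {γ : ℝ → ι → ℝ}
    (hγ : IsUnitSphereCurve γ) {ε : ℝ} (hε : 0 < ε) :
    ∃ (Y : Sol3 → ι ⊕ ι → ℝ) (n K : ℝ → ℝ), IsWarpedBlock 2 (fun t => Real.exp (-t)) ε Y n K ∧
      (IsInducing γ → DeterminesCoord 2 Y) ∧ (Periodic γ (2 * Real.pi) →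
        ∃ q q' : Sol3, q ≠ q' ∧ q 0 = q' 0 ∧ q 1 = q' 1 ∧ Y q = Y q') := by
  obtain ⟨Y, n, K, hY, hYi, hYp⟩ := exists_isWarpedBlock hγ (m := 2) (by simp)
    (Real.contDiff_exp.comp contDiff_neg) (fun t => (Real.exp_pos (-t)).ne') hε
  refine ⟨Y, n, K, hY, hYi, fun hp => ?_⟩
  obtain ⟨q, q', hne, hq, h⟩ := (hYp hp).exists_ne
  exact ⟨q, q', hne, hq 0 (by simp), hq 1 (by simp), h⟩

/-- With no quadric equation to satisfy, `φ` corrects `dt²`: `-eᵗ φ' = 1 - K`. -/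
theorem exists_lorentzian_pair {ι : Type*} [Fintype ι] {γ : ℝ → ι → ℝ}
    (hγ : IsUnitSphereCurve γ) :
    ∃ (F : Sol3 → Unit ⊕ Empty → ℝ) (G : Sol3 → (Unit ⊕ Unit) ⊕ (ι ⊕ ι) → ℝ),
      IsIsometricPair F G ∧ (IsInducing γ → IsInducing fun q => (F q, G q)) ∧
      (Periodic γ (2 * Real.pi) → ∃ q q' : Sol3, q ≠ q' ∧ F q = F q' ∧ G q = G q') := by
  obtain ⟨Y, n, K, hY, hYi, hYp⟩ := exists_warpedBlock_exp_neg hγ one_pos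
  have hK := hY.smooth_energy
  obtain ⟨φ, hφ, hφd⟩ := exists_smooth_antideriv
    (g := fun t => Real.exp (-t) * (K t - 1)) (by fun_prop)
  refine ⟨_, _, isIsometricPair_null hφ hφd HasNormEnergy.empty hY.normEnergy fun q v => ?_,
    fun hi => isInducing_null hφ HasNormEnergy.empty.smooth hY.normEnergy.smooth (hYi hi),
    fun hp => ?_⟩
  · have h : Real.exp (q 0) * Real.exp (-q 0) = 1 := by rw [← Real.exp_add]; simp
    linear_combination -(K (q 0) - 1) * v 0 ^ 2 * h
  · obtain ⟨q, q', hne, h0, h1, h⟩ := hYp hp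
    exact ⟨q, q', hne, by ext (i | i) <;> simp [nullNeg, h0, h1], by simp only [nullPos, h0, h1, h]⟩

/-- The pair `(F, G)` takes values in the quadric `⟨x, x⟩ = s` and factors, within that quadric,
through a non-injective map to a simply connected, locally path-connected space. -/
def FactorsNonInjectively {ι κ : Type} [Fintype ι] [Fintype κ] (s : ℝ) (F : Sol3 → ι → ℝ)
    (G : Sol3 → κ → ℝ) : Prop :=
  ∃ (T : Type) (_ : TopologicalSpace T) (_ : SimplyConnectedSpace T)
    (_ : LocallyPathConnectedSpace T) (π : Sol3 → T) (A : T → ι → ℝ) (B : T → κ → ℝ),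
    Continuous π ∧ ¬ Injective π ∧ Continuous A ∧ Continuous B ∧
      (∀ x, -∑ i, A x i ^ 2 + ∑ i, B x i ^ 2 = s) ∧ (∀ q, F q = A (π q)) ∧ ∀ q, G q = B (π q)

/-- The quadric equation fixes `φ = e^{-t} (n + σ² - 1/c)` for one extra positive coordinate `σ(t)`.
The `dt²` balance then becomes `(σ' - σ)² = 1 + 1/c - K - n + n'`, a linear equation for `σ` after
taking a root, solved by `σ = eᵗ τ`. -/
theorem exists_deSitter_pair {ι : Type} [Fintype ι] {γ : ℝ → ι → ℝ}
    (hγ : IsUnitSphereCurve γ) {c : ℝ} (hc : 0 < c) :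
    ∃ (F : Sol3 → Unit ⊕ Empty → ℝ) (G : Sol3 → (Unit ⊕ Unit) ⊕ ((ι ⊕ ι) ⊕ Unit) → ℝ),
      IsIsometricPair F G ∧ (∀ q, -∑ i, F q i ^ 2 + ∑ i, G q i ^ 2 = 1 / c) ∧
      (IsInducing γ → IsInducing fun q => (F q, G q)) ∧
      (Periodic γ (2 * Real.pi) → FactorsNonInjectively (1 / c) F G) := by
  obtain ⟨Y, n, K, hY, hYi, hYp⟩ := exists_warpedBlock_exp_neg hγ (ε := 1 / 4) (by norm_num)
  have hK := hY.smooth_energy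
  have hn := hY.smooth_norm
  have hn' : ContDiff ℝ ∞ (deriv n) := (contDiff_infty_iff_deriv.1 hn).2
  have hnd : ∀ t, HasDerivAt n (deriv n t) t := fun t =>
    (hn.differentiable (by simp) t).hasDerivAt
  -- Each of `K`, `n`, `|n'|` is at most `1/4`, so together they cannot exhaust the `1`.
  have hpos : ∀ t, 0 < 1 + 1 / c - K t - n t + deriv n t := fun t => by
    have h1 := hY.energy_le t
    have h2 := hY.norm_le t
    have h3 := (abs_le.1 (hY.abs_deriv_le t)).1
    have h4 : 0 < 1 / c := by positivity
    linarith
  obtain ⟨k, hk⟩ : ∃ k : ℝ → ℝ, ∀ t, k t = √(1 + 1 / c - K t - n t + deriv n t) :=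
    ⟨_, fun _ => rfl⟩
  have hks : ContDiff ℝ ∞ k := by
    rw [show k = _ from funext hk]
    exact ContDiff.sqrt (by fun_prop) fun t => (hpos t).ne'
  have hksq : ∀ t, k t ^ 2 = 1 + 1 / c - K t - n t + deriv n t := fun t => by
    rw [hk, Real.sq_sqrt (hpos t).le]
  obtain ⟨τ, hτ, hτd⟩ := exists_smooth_antideriv (g := fun t => Real.exp (-t) * k t) (by fun_prop)
  have hexp : ∀ t : ℝ, Real.exp t * Real.exp (-t) = 1 := fun t => by rw [← Real.exp_add]; simp
  obtain ⟨σ, hσ⟩ : ∃ σ : ℝ → ℝ, ∀ t, σ t = Real.exp t * τ t := ⟨_, fun _ => rfl⟩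
  have hσs : ContDiff ℝ ∞ σ := by
    rw [show σ = _ from funext hσ]; fun_prop
  have hσd : ∀ t, HasDerivAt σ (σ t + k t) t := fun t => by
    rw [show σ = _ from funext hσ]
    refine ((Real.hasDerivAt_exp t).fun_mul (hτd t)).congr_deriv ?_
    linear_combination k t * hexp t
  have hφd : ∀ t, HasDerivAt (fun t => Real.exp (-t) * (n t + σ t ^ 2 - 1 / c))
      (Real.exp (-t) * (deriv n t + 2 * σ t * (σ t + k t) - (n t + σ t ^ 2 - 1 / c))) t := fun t =>
    ((hasDerivAt_neg t).exp.fun_mul (((hnd t).fun_add ((hσd t).fun_pow 2)).sub_const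
      (1 / c))).congr_deriv (by simp; ring)
  have hφ : ContDiff ℝ ∞ fun t => Real.exp (-t) * (n t + σ t ^ 2 - 1 / c) := by fun_prop
  have hR := hY.normEnergy.sumElim (HasNormEnergy.of_time hσs hσd)
  have hquad : ∀ a u x N S : ℝ, a * u = 1 →
      -((a + (a * x ^ 2 + u * (N + S ^ 2 - 1 / c))) / 2) ^ 2 +
      (((a - (a * x ^ 2 + u * (N + S ^ 2 - 1 / c))) / 2) ^ 2 + (a * x) ^ 2 + (N + S ^ 2)) =
        1 / c := fun a u x N S h => by
    linear_combination -(N + S ^ 2 - 1 / c) * h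
  refine ⟨_, _, isIsometricPair_null hφ hφd HasNormEnergy.empty hR fun q v => ?_, fun q => ?_,
    fun hi => isInducing_null hφ HasNormEnergy.empty.smooth hR.smooth ((hYi hi).sumElim _),
    fun hp => ?_⟩
  · linear_combination v 0 ^ 2 * hksq (q 0) - (deriv n (q 0) + 2 * σ (q 0) * (σ (q 0) + k (q 0)) -
      (n (q 0) + σ (q 0) ^ 2 - 1 / c)) * v 0 ^ 2 * hexp (q 0)
  · have e1 := ((hasNormEnergy_nullNeg hφ hφd).sumElim HasNormEnergy.empty).norm q
    have e2 := ((hasNormEnergy_nullPos hφ hφd).sumElim hR).norm q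
    beta_reduce at e1 e2 ⊢
    rw [e1, e2, add_zero]
    exact hquad _ _ _ _ _ (hexp _)
  · obtain ⟨q, q', hne, h0, h1, h⟩ := hYp hp
    -- The pair depends only on `(t, x, Y)`. Replacing `n` by `∑ Yᵢ²` extends it to all such triples
    -- without leaving the quadric.
    refine ⟨ℝ × ℝ × (ι ⊕ ι → ℝ), inferInstance, inferInstance, inferInstance,
      fun q => (q 0, q 1, Y q),
      fun x => Sum.elim (fun _ => (Real.exp x.1 + (Real.exp x.1 * x.2.1 ^ 2 +
        Real.exp (-x.1) * (∑ i, x.2.2 i ^ 2 + σ x.1 ^ 2 - 1 / c))) / 2) fun i => i.elim,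
      fun x => Sum.elim (Sum.elim (fun _ => (Real.exp x.1 - (Real.exp x.1 * x.2.1 ^ 2 +
        Real.exp (-x.1) * (∑ i, x.2.2 i ^ 2 + σ x.1 ^ 2 - 1 / c))) / 2)
          fun _ => Real.exp x.1 * x.2.1) (Sum.elim x.2.2 fun _ => σ x.1), ?_, ?_, ?_, ?_, ?_, ?_, ?_⟩
    · have := hY.normEnergy.smooth.continuous
      fun_prop
    · exact fun hinj => hne (hinj (by simp only [h0, h1, h]))
    · have := hσs.continuous
      refine continuous_pi ?_
      rintro (i | i)
      · simp only [Sum.elim_inl]; fun_prop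
      · exact i.elim
    · have := hσs.continuous
      refine continuous_pi ?_
      rintro ((i | i) | (i | i)) <;> simp only [Sum.elim_inl, Sum.elim_inr] <;> fun_prop
    · intro x
      simpa [Fintype.sum_sum_type] using hquad _ _ x.2.1 (∑ i, x.2.2 i ^ 2) (σ x.1) (hexp x.1)
    · intro q
      ext (i | i)
      · simp only [Sum.elim_inl, nullNeg, hY.normEnergy.norm]
      · exact i.elim
    · intro q
      simp only [nullPos, hY.normEnergy.norm]

/-- The extra coordinates form a Lorentzian plane with form `-dα dβ`, and the quadric fixes `φ =
e^{-t} (n - αβ + 1/c)`. The balance reads `-(α' - α)(β' - β) = k`. A product may have any sign, so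
no root or smallness is needed: `α' - α = eᵗ` and `β' - β = -e^{-t} k` solve it. -/
theorem exists_antiDeSitter_pair {ι : Type} [Fintype ι] {γ : ℝ → ι → ℝ}
    (hγ : IsUnitSphereCurve γ) (c : ℝ) :
    ∃ (F : Sol3 → Unit ⊕ Unit → ℝ) (G : Sol3 → (Unit ⊕ Unit) ⊕ ((ι ⊕ ι) ⊕ Unit) → ℝ),
      IsIsometricPair F G ∧ (∀ q, -∑ i, F q i ^ 2 + ∑ i, G q i ^ 2 = -(1 / c)) ∧
      (IsInducing γ → IsInducing fun q => (F q, G q)) ∧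
      (Periodic γ (2 * Real.pi) → FactorsNonInjectively (-(1 / c)) F G) := by
  obtain ⟨Y, n, K, hY, hYi, hYp⟩ := exists_warpedBlock_exp_neg hγ one_pos
  have hK := hY.smooth_energy
  have hn := hY.smooth_norm
  have hn' : ContDiff ℝ ∞ (deriv n) := (contDiff_infty_iff_deriv.1 hn).2
  have hnd : ∀ t, HasDerivAt n (deriv n t) t := fun t =>
    (hn.differentiable (by simp) t).hasDerivAt
  have hexp : ∀ t : ℝ, Real.exp t * Real.exp (-t) = 1 := fun t => by rw [← Real.exp_add]; simp
  obtain ⟨k, hk⟩ : ∃ k : ℝ → ℝ, ∀ t, k t = 1 - 1 / c - K t - n t + deriv n t := ⟨_, fun _ => rfl⟩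
  have hks : ContDiff ℝ ∞ k := by rw [show k = _ from funext hk]; fun_prop
  obtain ⟨τ, hτ, hτd⟩ := exists_smooth_antideriv
    (g := fun t => -(Real.exp (-t) * Real.exp (-t) * k t)) (by fun_prop)
  -- null coordinates `α`, `β` of the remaining Lorentzian plane
  obtain ⟨α, hα⟩ : ∃ α : ℝ → ℝ, ∀ t, α t = Real.exp t * t := ⟨_, fun _ => rfl⟩
  have hαs : ContDiff ℝ ∞ α := by rw [show α = _ from funext hα]; fun_prop
  have hαd : ∀ t, HasDerivAt α (α t + Real.exp t) t := fun t => by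
    rw [show α = _ from funext hα]
    exact ((Real.hasDerivAt_exp t).fun_mul (hasDerivAt_id' t)).congr_deriv (by ring)
  obtain ⟨β, hβ⟩ : ∃ β : ℝ → ℝ, ∀ t, β t = Real.exp t * τ t := ⟨_, fun _ => rfl⟩
  have hβs : ContDiff ℝ ∞ β := by rw [show β = _ from funext hβ]; fun_prop
  have hβd : ∀ t, HasDerivAt β (β t - Real.exp (-t) * k t) t := fun t => by
    rw [show β = _ from funext hβ]
    refine ((Real.hasDerivAt_exp t).fun_mul (hτd t)).congr_deriv ?_
    linear_combination -Real.exp (-t) * k t * hexp t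
  have hφd : ∀ t, HasDerivAt (fun t => Real.exp (-t) * (n t - α t * β t + 1 / c))
      (Real.exp (-t) * (deriv n t - ((α t + Real.exp t) * β t +
        α t * (β t - Real.exp (-t) * k t)) - (n t - α t * β t + 1 / c))) t := fun t =>
    ((hasDerivAt_neg t).exp.fun_mul (((hnd t).fun_sub ((hαd t).fun_mul (hβd t))).add_const
      (1 / c))).congr_deriv (by simp; ring)
  have hφ : ContDiff ℝ ∞ fun t => Real.exp (-t) * (n t - α t * β t + 1 / c) := by fun_prop
  have hS := HasNormEnergy.of_time (φ := fun t => (α t + β t) / 2) (by fun_prop)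
    fun t => ((hαd t).fun_add (hβd t)).div_const 2
  have hR := hY.normEnergy.sumElim (HasNormEnergy.of_time (φ := fun t => (α t - β t) / 2)
    (by fun_prop) fun t => ((hαd t).fun_sub (hβd t)).div_const 2)
  have hquad : ∀ a u x N p r : ℝ, a * u = 1 →
      -(((a + (a * x ^ 2 + u * (N - p * r + 1 / c))) / 2) ^ 2 + ((p + r) / 2) ^ 2) +
      (((a - (a * x ^ 2 + u * (N - p * r + 1 / c))) / 2) ^ 2 + (a * x) ^ 2 +
        (N + ((p - r) / 2) ^ 2)) = -(1 / c) := fun a u x N p r h => by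
    linear_combination -(N - p * r + 1 / c) * h
  refine ⟨_, _, isIsometricPair_null hφ hφd hS hR fun q v => ?_, fun q => ?_,
    fun hi => isInducing_null hφ hS.smooth hR.smooth ((hYi hi).sumElim _), fun hp => ?_⟩
  · linear_combination v 0 ^ 2 * hk (q 0) + k (q 0) * v 0 ^ 2 * hexp (q 0) -
      (deriv n (q 0) - ((α (q 0) + Real.exp (q 0)) * β (q 0) +
        α (q 0) * (β (q 0) - Real.exp (-q 0) * k (q 0))) -
        (n (q 0) - α (q 0) * β (q 0) + 1 / c)) * v 0 ^ 2 * hexp (q 0)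
  · have e1 := ((hasNormEnergy_nullNeg hφ hφd).sumElim hS).norm q
    have e2 := ((hasNormEnergy_nullPos hφ hφd).sumElim hR).norm q
    beta_reduce at e1 e2 ⊢
    rw [e1, e2]
    exact hquad _ _ _ _ _ _ (hexp _)
  · obtain ⟨q, q', hne, h0, h1, h⟩ := hYp hp
    refine ⟨ℝ × ℝ × (ι ⊕ ι → ℝ), inferInstance, inferInstance, inferInstance,
      fun q => (q 0, q 1, Y q),
      fun x => Sum.elim (fun _ => (Real.exp x.1 + (Real.exp x.1 * x.2.1 ^ 2 +
        Real.exp (-x.1) * (∑ i, x.2.2 i ^ 2 - α x.1 * β x.1 + 1 / c))) / 2)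
          fun _ => (α x.1 + β x.1) / 2,
      fun x => Sum.elim (Sum.elim (fun _ => (Real.exp x.1 - (Real.exp x.1 * x.2.1 ^ 2 +
        Real.exp (-x.1) * (∑ i, x.2.2 i ^ 2 - α x.1 * β x.1 + 1 / c))) / 2)
          fun _ => Real.exp x.1 * x.2.1) (Sum.elim x.2.2 fun _ => (α x.1 - β x.1) / 2),
      ?_, ?_, ?_, ?_, ?_, ?_, ?_⟩
    · have := hY.normEnergy.smooth.continuous
      fun_prop
    · exact fun hinj => hne (hinj (by simp only [h0, h1, h]))
    · have := hαs.continuous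
      have := hβs.continuous
      refine continuous_pi ?_
      rintro (i | i) <;> simp only [Sum.elim_inl, Sum.elim_inr] <;> fun_prop
    · have := hαs.continuous
      have := hβs.continuous
      refine continuous_pi ?_
      rintro ((i | i) | (i | i)) <;> simp only [Sum.elim_inl, Sum.elim_inr] <;> fun_prop
    · intro x
      simpa [Fintype.sum_sum_type] using
        hquad _ _ x.2.1 (∑ i, x.2.2 i ^ 2) (α x.1) (β x.1) (hexp x.1)
    · intro q
      ext (i | i) <;> simp only [Sum.elim_inl, Sum.elim_inr, nullNeg, hY.normEnergy.norm]
    · intro q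
      simp only [nullPos, hY.normEnergy.norm]

/-! ### Realization in the targets and lifting to coverings -/

section Targets

variable {ι κ : Type} [Fintype ι] [Fintype κ] {N a : ℕ} {e : ι ⊕ κ → Fin N} {F : Sol3 → ι → ℝ}
  {G : Sol3 → κ → ℝ} {s : ℝ}

theorem IsIsometricPair.continuous_placePair (h : IsIsometricPair F G) (e : ι ⊕ κ → Fin N) :
    Continuous fun q => placePair e (F q) (G q) :=
  _root_.continuous_placePair e h.smooth_neg.continuous h.smooth_pos.continuous

theorem IsIsometricPair.admitsEmbedding_flat (h : IsIsometricPair F G)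
    (he : IsSignatureInjection a e) (hi : IsInducing fun q => (F q, G q)) :
    AdmitsEmbedding a (flatChart N) :=
  h.admitsEmbedding he hi continuous_id (h.continuous_placePair e) fun _ => rfl

theorem IsIsometricPair.admitsNonInjectiveImmersion_flat (h : IsIsometricPair F G)
    (he : IsSignatureInjection a e)
    (hn : ∃ q q' : Sol3, q ≠ q' ∧ F q = F q' ∧ G q = G q') :
    AdmitsNonInjectiveImmersion a (flatChart N) := by
  obtain ⟨q, q', hne, hF, hG⟩ := hn
  exact ⟨_, h.isSmoothIsometricImmersion he (j := flatChart N) (h.continuous_placePair e)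
    fun _ => rfl, fun hinj => hne (hinj (by simp only [hF, hG]))⟩

theorem IsIsometricPair.admitsEmbedding_quadric (h : IsIsometricPair F G)
    (he : IsSignatureInjection a e) (hi : IsInducing fun q => (F q, G q))
    {Q : Set (Fin N → ℝ)} (hQ : ∀ q, placePair e (F q) (G q) ∈ Q) :
    AdmitsEmbedding a (quadricChart Q) :=
  h.admitsEmbedding he hi continuous_subtype_val
    ((h.continuous_placePair e).subtype_mk hQ) fun _ => rfl

theorem IsIsometricPair.admitsNonInjectiveImmersion_quadric (h : IsIsometricPair F G)
    (he : IsSignatureInjection a e)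
    (hn : ∃ q q' : Sol3, q ≠ q' ∧ F q = F q' ∧ G q = G q')
    {Q : Set (Fin N → ℝ)} (hQ : ∀ q, placePair e (F q) (G q) ∈ Q) :
    AdmitsNonInjectiveImmersion a (quadricChart Q) := by
  obtain ⟨q, q', hne, hF, hG⟩ := hn
  exact ⟨_, h.isSmoothIsometricImmersion he (j := quadricChart Q)
    ((h.continuous_placePair e).subtype_mk hQ) fun _ => rfl,
    fun hinj => hne (hinj (by simp only [hF, hG]))⟩

theorem IsUniversalCovering.exists_lift {E : Type u} {X T : Type*} [TopologicalSpace E]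
    [TopologicalSpace X] [TopologicalSpace T] [SimplyConnectedSpace T]
    [LocallyPathConnectedSpace T] {p : E → X} (hp : IsUniversalCovering p) {f : T → X}
    (hf : Continuous f) : ∃ g : T → E, Continuous g ∧ ∀ x, p (g x) = f x := by
  obtain ⟨x₀⟩ : Nonempty T := inferInstance
  obtain ⟨y, hy⟩ := hp.surjective (f x₀)
  obtain ⟨g, ⟨-, hg⟩, -⟩ := hp.isCoveringMap.existsUnique_continuousMap_lifts ⟨f, hf⟩ x₀ y hy
  exact ⟨g, g.continuous, congrFun hg⟩

/-- `Sol₃` is simply connected, so the map lifts; the lift inherits the inducing property from its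
projection. -/
theorem IsIsometricPair.admitsEmbedding_cover (h : IsIsometricPair F G)
    (he : IsSignatureInjection a e) (hi : IsInducing fun q => (F q, G q))
    {Q : Set (Fin N → ℝ)} (hQ : ∀ q, placePair e (F q) (G q) ∈ Q) {E : Type u}
    [TopologicalSpace E] {p : E → Q} (hp : IsUniversalCovering p) :
    AdmitsEmbedding a (coverChart p) := by
  obtain ⟨f, hf, hpf⟩ := hp.exists_lift ((h.continuous_placePair e).subtype_mk hQ)
  exact h.admitsEmbedding he hi (continuous_subtype_val.comp hp.isCoveringMap.continuous) hf
    fun q => congrArg Subtype.val (hpf q)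

theorem IsSignatureInjection.placePair_mem (he : IsSignatureInjection a e) {z : ι → ℝ}
    {w : κ → ℝ} (h : -∑ i, z i ^ 2 + ∑ i, w i ^ 2 = s) :
    placePair e z w ∈ {x | semiInner a x x = s} := by
  rw [Set.mem_ofPred_eq, he.semiInner_placePair, ← h]
  simp only [sq]

/-- Two points with the same image in the quadric could have distinct lifts. Lifting the map from
`T` and then composing with `π` keeps the identification made by `π`. -/
theorem IsIsometricPair.admitsNonInjectiveImmersion_cover (h : IsIsometricPair F G)
    (he : IsSignatureInjection a e) (hn : FactorsNonInjectively s F G) {E : Type u}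
    [TopologicalSpace E] {p : E → {x : Fin N → ℝ | semiInner a x x = s}}
    (hp : IsUniversalCovering p) : AdmitsNonInjectiveImmersion a (coverChart p) := by
  obtain ⟨T, _, _, _, π, A, B, hπ, hinj, hA, hB, hAB, hF, hG⟩ := hn
  obtain ⟨f, hf, hpf⟩ := hp.exists_lift ((_root_.continuous_placePair e hA hB).subtype_mk
    fun x => he.placePair_mem (hAB x))
  refine ⟨f ∘ π, h.isSmoothIsometricImmersion he (hf.comp hπ) fun q => ?_,
    fun hi => hinj hi.of_comp⟩
  rw [hF, hG]
  exact congrArg Subtype.val (hpf (π q))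

theorem FactorsNonInjectively.exists_ne (h : FactorsNonInjectively s F G) :
    ∃ q q' : Sol3, q ≠ q' ∧ F q = F q' ∧ G q = G q' := by
  obtain ⟨T, _, _, _, π, A, B, -, hinj, -, -, -, hF, hG⟩ := h
  simp only [Injective, not_forall] at hinj
  obtain ⟨q, q', hq, hne⟩ := hinj
  exact ⟨q, q', hne, by rw [hF, hF, hq], by rw [hG, hG, hq]⟩

theorem placePair_mem_hyperbolicSpace {n : ℕ} {c : ℝ} {e : Unit ⊕ κ → Fin (n + 1)}
    (he : IsSignatureInjection 1 e) {z : Unit → ℝ} {w : κ → ℝ}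
    (h : -∑ i, z i ^ 2 + ∑ i, w i ^ 2 = -(1 / c)) (hz : ∀ i, 0 < z i) :
    placePair e z w ∈ hyperbolicSpace n c := by
  refine ⟨he.placePair_mem h, ?_⟩
  have h0 : e (.inl ()) = 0 := Fin.ext (Nat.lt_one_iff.1 (he.neg ()))
  rw [← h0, placePair, placeCoords_apply he.injective]
  exact hz ()

end Targets

theorem mainTheorem3 (c : ℝ) (hc : 0 < c) :
    -- non-injective smooth isometric immersions
    (AdmitsNonInjectiveImmersion 0 (flatChart 9) ∧
      AdmitsNonInjectiveImmersion 1 (quadricChart (hyperbolicSpace 9 c)) ∧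
      AdmitsNonInjectiveImmersion 0 (quadricChart (pseudoSphere 9 0 c)) ∧
      AdmitsNonInjectiveImmersion 1 (flatChart 7) ∧
      -- the quadric `S^7_1(c)` and its universal covering `dS^7(c)`
      (AdmitsNonInjectiveImmersion 1 (quadricChart (pseudoSphere 7 1 c)) ∧
        ∀ (E : Type u) [TopologicalSpace E] (p : E → pseudoSphere 7 1 c),
          IsUniversalCovering p → AdmitsNonInjectiveImmersion 1 (coverChart p)) ∧
      -- the quadric `H^8_1(-c)` and its universal covering `AdS^8(-c)`
      (AdmitsNonInjectiveImmersion 2 (quadricChart (pseudoHyperbolic 8 1 c)) ∧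
        ∀ (E : Type u) [TopologicalSpace E] (p : E → pseudoHyperbolic 8 1 c),
          IsUniversalCovering p → AdmitsNonInjectiveImmersion 2 (coverChart p))) ∧
    -- smooth isometric embeddings
    (AdmitsEmbedding 0 (flatChart 17) ∧
      AdmitsEmbedding 1 (quadricChart (hyperbolicSpace 17 c)) ∧
      AdmitsEmbedding 0 (quadricChart (pseudoSphere 19 0 c)) ∧
      AdmitsEmbedding 1 (flatChart 11) ∧
      -- the quadric `H^12_1(-c)` and its universal covering `AdS^12(-c)`
      (AdmitsEmbedding 2 (quadricChart (pseudoHyperbolic 12 1 c)) ∧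
        ∀ (E : Type u) [TopologicalSpace E] (p : E → pseudoHyperbolic 12 1 c),
          IsUniversalCovering p → AdmitsEmbedding 2 (coverChart p)) ∧
      -- the quadric `S^13_1(c)` and its universal covering `dS^13(c)`
      (AdmitsEmbedding 1 (quadricChart (pseudoSphere 13 1 c)) ∧
        ∀ (E : Type u) [TopologicalSpace E] (p : E → pseudoSphere 13 1 c),
          IsUniversalCovering p → AdmitsEmbedding 1 (coverChart p))) := by
  -- Dimension count: a warped block takes four coordinates with the circle and six with the spiral.
  -- The immersions fill their ambient spaces exactly; the embeddings leave positive coordinates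
  -- zero.
  have hγ := isUnitSphereCurve_circleCurve
  have hper := circleCurve_periodic
  obtain ⟨γ, hσ, hind⟩ := exists_isInducing_unitSphereCurve
  refine ⟨⟨?_, ?_, ?_, ?_, ?_, ?_⟩, ?_, ?_, ?_, ?_, ?_, ?_⟩
  · obtain ⟨F, G, h, -, hn⟩ := exists_euclidean_pair hγ
    obtain ⟨e, he⟩ := exists_isSignatureInjection Empty (((Fin 2 ⊕ Fin 2) ⊕ (Fin 2 ⊕ Fin 2)) ⊕ Unit)
      (a := 0) (N := 9) (by simp) (by simp)
    obtain ⟨q, q', hne, hG⟩ := hn hper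
    exact h.admitsNonInjectiveImmersion_flat he ⟨q, q', hne, Subsingleton.elim _ _, hG⟩
  · obtain ⟨F, G, h, hs, hpos, -, hn⟩ := exists_hyperbolic_pair hγ hc
    obtain ⟨e, he⟩ := exists_isSignatureInjection Unit (((Fin 2 ⊕ Fin 2) ⊕ (Fin 2 ⊕ Fin 2)) ⊕ Unit)
      (a := 1) (N := 9 + 1) (by simp) (by simp)
    exact h.admitsNonInjectiveImmersion_quadric he (hn hper)
      fun q => placePair_mem_hyperbolicSpace he (hs q) (hpos q)
  · obtain ⟨F, G, h, hs, -, hn⟩ := exists_spherical_pair hγ hc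
    obtain ⟨e, he⟩ := exists_isSignatureInjection Empty
      (((Fin 2 ⊕ Fin 2) ⊕ (Fin 2 ⊕ Fin 2)) ⊕ Fin 2) (a := 0) (N := 9 + 1) (by simp) (by simp)
    obtain ⟨q, q', hne, hG⟩ := hn hper
    exact h.admitsNonInjectiveImmersion_quadric he ⟨q, q', hne, Subsingleton.elim _ _, hG⟩
      fun q => he.placePair_mem (hs q)
  · obtain ⟨F, G, h, -, hn⟩ := exists_lorentzian_pair hγ
    obtain ⟨e, he⟩ := exists_isSignatureInjection (Unit ⊕ Empty)
      ((Unit ⊕ Unit) ⊕ (Fin 2 ⊕ Fin 2)) (a := 1) (N := 7) (by simp) (by simp)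
    exact h.admitsNonInjectiveImmersion_flat he (hn hper)
  · obtain ⟨F, G, h, hs, -, hn⟩ := exists_deSitter_pair hγ hc
    obtain ⟨e, he⟩ := exists_isSignatureInjection (Unit ⊕ Empty)
      ((Unit ⊕ Unit) ⊕ ((Fin 2 ⊕ Fin 2) ⊕ Unit)) (a := 1) (N := 7 + 1) (by simp) (by simp)
    exact ⟨h.admitsNonInjectiveImmersion_quadric he (hn hper).exists_ne
      fun q => he.placePair_mem (hs q),
      fun E _ p hp => h.admitsNonInjectiveImmersion_cover he (hn hper) hp⟩
  · obtain ⟨F, G, h, hs, -, hn⟩ := exists_antiDeSitter_pair hγ c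
    obtain ⟨e, he⟩ := exists_isSignatureInjection (Unit ⊕ Unit)
      ((Unit ⊕ Unit) ⊕ ((Fin 2 ⊕ Fin 2) ⊕ Unit)) (a := 2) (N := 8 + 1) (by simp) (by simp)
    exact ⟨h.admitsNonInjectiveImmersion_quadric he (hn hper).exists_ne
      fun q => he.placePair_mem (hs q),
      fun E _ p hp => h.admitsNonInjectiveImmersion_cover he (hn hper) hp⟩
  · obtain ⟨F, G, h, hi, -⟩ := exists_euclidean_pair hσ
    obtain ⟨e, he⟩ := exists_isSignatureInjection Empty (((Fin 3 ⊕ Fin 3) ⊕ (Fin 3 ⊕ Fin 3)) ⊕ Unit)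
      (a := 0) (N := 17) (by simp) (by simp)
    exact h.admitsEmbedding_flat he (hi hind)
  · obtain ⟨F, G, h, hs, hpos, hi, -⟩ := exists_hyperbolic_pair hσ hc
    obtain ⟨e, he⟩ := exists_isSignatureInjection Unit (((Fin 3 ⊕ Fin 3) ⊕ (Fin 3 ⊕ Fin 3)) ⊕ Unit)
      (a := 1) (N := 17 + 1) (by simp) (by simp)
    exact h.admitsEmbedding_quadric he (hi hind)
      fun q => placePair_mem_hyperbolicSpace he (hs q) (hpos q)
  · obtain ⟨F, G, h, hs, hi, -⟩ := exists_spherical_pair hσ hc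
    obtain ⟨e, he⟩ := exists_isSignatureInjection Empty
      (((Fin 3 ⊕ Fin 3) ⊕ (Fin 3 ⊕ Fin 3)) ⊕ Fin 3) (a := 0) (N := 19 + 1) (by simp) (by simp)
    exact h.admitsEmbedding_quadric he (hi hind) fun q => he.placePair_mem (hs q)
  · obtain ⟨F, G, h, hi, -⟩ := exists_lorentzian_pair hσ
    obtain ⟨e, he⟩ := exists_isSignatureInjection (Unit ⊕ Empty)
      ((Unit ⊕ Unit) ⊕ (Fin 3 ⊕ Fin 3)) (a := 1) (N := 11) (by simp) (by simp)
    exact h.admitsEmbedding_flat he (hi hind)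
  · obtain ⟨F, G, h, hs, hi, -⟩ := exists_antiDeSitter_pair hσ c
    obtain ⟨e, he⟩ := exists_isSignatureInjection (Unit ⊕ Unit)
      ((Unit ⊕ Unit) ⊕ ((Fin 3 ⊕ Fin 3) ⊕ Unit)) (a := 2) (N := 12 + 1) (by simp) (by simp)
    have hQ := fun q => he.placePair_mem (hs q)
    exact ⟨h.admitsEmbedding_quadric he (hi hind) hQ,
      fun E _ p hp => h.admitsEmbedding_cover he (hi hind) hQ hp⟩
  · obtain ⟨F, G, h, hs, hi, -⟩ := exists_deSitter_pair hσ hc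
    obtain ⟨e, he⟩ := exists_isSignatureInjection (Unit ⊕ Empty)
      ((Unit ⊕ Unit) ⊕ ((Fin 3 ⊕ Fin 3) ⊕ Unit)) (a := 1) (N := 13 + 1) (by simp) (by simp)
    have hQ := fun q => he.placePair_mem (hs q)
    exact ⟨h.admitsEmbedding_quadric he (hi hind) hQ,
      fun E _ p hp => h.admitsEmbedding_cover he (hi hind) hQ hp⟩
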